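/- Scheduling model. An instance consists of $n$ jobs, all released at time $0$. A job is a finite sequence of phases; a phase has a work $w\ge 0$ and a speed-up function $\Gamma:[0,\infty)\to[0,\infty)$ that is non-decreasing and sub-linear (i.e. $\Gamma(\rho')/\rho'\le\Gamma(\rho)/\rho$ for $0<\rho<\rho'$). A schedule on $p$ processors consists of piecewise constant functions $\rho_j:[0,\infty)\to[0,\infty)$, $j=1,\dots,n$, with $\sum_j\rho_j(t)\le p$ for all $t$ ($p$ may be any positive real). The phases of a job are processed one after the other from time $0$ on, and a phase of job $j$ with data $(w,\Gamma)$ started at time $t_0$ is finished at the first time $t_1$ with $\int_{t_0}^{t_1}\Gamma(\rho_j(t))\,dt=w$. A job is completed when its last phase is finished (at time $\infty$ if this never happens), the makespan of a schedule is the largest completion time, and $\mathrm{OPT}_p(S)$ is the infimum of the makespans of all schedules of the instance $S$ on $p$ processors. A (deterministic) non-clairvoyant algorithm for $n$ jobs on $P$ processors assigns to each instance of $n$ jobs a schedule on $P$ processors such that the allotment at time $t$ depends only on which jobs have been completed at which times up to time $t$. A randomized one is a random variable whose values are deterministic ones, such that the makespan on each instance is measurable. An algorithm on $sp$ processors is $s$-speed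 $c$-competitive on instances of $n$ jobs (with respect to $p$ processors) if on every instance $S$ of $n$ jobs its makespan (its expected makespan, if it is randomized) is at most $c\cdot\mathrm{OPT}_p(S)$; "$c$-competitive" means $1$-speed $c$-competitive. Equi on $p$ processors allots, at each time $t$, $p/N(t)$ processors to each of the $N(t)$ jobs uncompleted at time $t$, and none to the completed jobs. Theorem (makespan minimization). 1. For every $n$ and every $p>0$, Equi is a well-defined non-clairvoyant algorithm: there is exactly one non-clairvoyant algorithm for $n$ jobs on $p$ processors that follows the rule above. There is a sequence $\varepsilon(n)\to0$ such that for all $n\ge3$ and all $p>0$, Equi on $p$ processors is $(1+\varepsilon(n))\frac{\ln n}{\ln\ln n}$-competitive on instances of $n$ jobs. 2. Let $s:\mathbb N\to[0,\infty)$ with $s(n)=o\left(\frac{\ln n}{\ln\ln n}\right)$. Then there is $N$ such that for all $n\ge N$ and all $p>0$: no deterministic non-clairvoyant algorithm is $s(n)$-speed $c$-competitive on instances of $n$ jobs with respect to $p$ processors for any $c<\frac{\ln n}{2\ln\ln n}$, and no randomized non-clairvoyant algorithm is so for any $c<\frac{\ln n}{4\ln\ln n}$. -/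

import Mathlib

open MeasureTheory Filter Topology Asymptotics
open scoped NNReal ENNReal

noncomputable section

namespace Scheduling

/-- A phase of a job: an amount of work together with a speed-up function `Γ`, which is
non-decreasing and sub-linear (`Γ(ρ)/ρ` is non-increasing in `ρ > 0`). -/
structure Phase where
  work : ℝ≥0
  speedUp : ℝ≥0 → ℝ≥0
  monotone_speedUp : Monotone speedUp
  sublinear_speedUp : ∀ ρ ρ' : ℝ≥0, 0 < ρ → ρ < ρ' → speedUp ρ' / ρ' ≤ speedUp ρ / ρ

/-- A job is a finite sequence of phases. -/
abbrev Job := List Phase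

/-- An instance: `n` jobs, all released at time `0`. -/
abbrev Instance (n : ℕ) := Fin n → Job

/-- The first time at which a phase started at time `t` is finished, if the job is allotted
`ρ u` processors at time `u`. It is `⊤` if this never happens (in particular if `t = ⊤`). The
accumulated work is continuous in `b`, so the first time at which it is at least `work` is the
first time at which it equals `work`. -/
def Phase.finishTime (φ : Phase) (ρ : ℝ≥0 → ℝ≥0) (t : ℝ≥0∞) : ℝ≥0∞ :=
  ⨅ (b : ℝ≥0) (_ : t ≤ b ∧
    (φ.work : ℝ≥0∞) ≤ ∫⁻ u in Set.Ico t.toReal (b : ℝ), (φ.speedUp (ρ u.toNNReal) : ℝ≥0∞)),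
    (b : ℝ≥0∞)

/-- The time at which the phases of a list, processed one after the other from time `t` on, are
all finished. -/
def finishTimeFrom (ρ : ℝ≥0 → ℝ≥0) : List Phase → ℝ≥0∞ → ℝ≥0∞
  | [], t => t
  | φ :: L, t => finishTimeFrom ρ L (φ.finishTime ρ t)

/-- The completion time of a job that is allotted `ρ u` processors at time `u`
(`⊤` if the job is never completed). -/
def completionTime (J : Job) (ρ : ℝ≥0 → ℝ≥0) : ℝ≥0∞ := finishTimeFrom ρ J 0

/-- On every bounded time interval `f` has finitely many breakpoints, and it does not change
between breakpoints. -/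
def IsPiecewiseConstant (f : ℝ≥0 → ℝ≥0) : Prop :=
  ∀ T : ℝ≥0, ∃ F : Finset ℝ≥0, ∀ a b : ℝ≥0, a ≤ b → b ≤ T →
    (∀ x ∈ F, x ∉ Set.Icc a b) → f a = f b

/-- `ρ` is a schedule of `n` jobs on `p` processors: `ρ j t` is the amount of processors allotted
to job `j` at time `t`. -/
def IsSchedule {n : ℕ} (p : ℝ≥0) (ρ : Fin n → ℝ≥0 → ℝ≥0) : Prop :=
  (∀ j, IsPiecewiseConstant (ρ j)) ∧ ∀ t, ∑ j, ρ j t ≤ p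

/-- The makespan of the jobs under the allotment `ρ` (`⊤` if some job is never completed). -/
def makespan {n : ℕ} (J : Instance n) (ρ : Fin n → ℝ≥0 → ℝ≥0) : ℝ≥0∞ :=
  ⨆ j, completionTime (J j) (ρ j)

/-- The optimal clairvoyant makespan on `p` processors. Schedules that are not valid have makespan
`⊤`, so the infimum is the infimum over the valid ones. -/
def opt {n : ℕ} (p : ℝ≥0) (J : Instance n) : ℝ≥0∞ :=
  ⨅ (ρ : Fin n → ℝ≥0 → ℝ≥0) (_ : IsSchedule p ρ), makespan J ρ

/-- A deterministic non-clairvoyant algorithm for `n` jobs on `P` processors: it computes a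
schedule for every instance, and the allotment at time `t` depends only on which jobs have been
completed by time `u`, for the times `u ≤ t`. -/
structure NonClairvoyantAlgorithm (n : ℕ) (P : ℝ≥0) where
  schedule : Instance n → Fin n → ℝ≥0 → ℝ≥0
  isSchedule : ∀ J, IsSchedule P (schedule J)
  nonClairvoyant : ∀ (J J' : Instance n) (t : ℝ≥0),
    (∀ (j : Fin n) (u : ℝ≥0), u ≤ t →
      (completionTime (J j) (schedule J j) ≤ u ↔ completionTime (J' j) (schedule J' j) ≤ u)) →
    ∀ j, schedule J j t = schedule J' j t

namespace NonClairvoyantAlgorithm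

variable {n : ℕ} {P : ℝ≥0}

/-- The jobs that are not completed at time `t` when the algorithm is run on `J`. -/
def uncompleted (A : NonClairvoyantAlgorithm n P) (J : Instance n) (t : ℝ≥0) : Set (Fin n) :=
  {j | (t : ℝ≥0∞) < completionTime (J j) (A.schedule J j)}

/-- The algorithm is Equi: at any time it splits the processors evenly among the uncompleted
jobs. -/
def IsEqui (A : NonClairvoyantAlgorithm n P) : Prop :=
  ∀ (J : Instance n) (t : ℝ≥0) (j : Fin n),
    (j ∈ A.uncompleted J t → A.schedule J j t = P / ((A.uncompleted J t).ncard : ℝ≥0)) ∧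
    (j ∉ A.uncompleted J t → A.schedule J j t = 0)

/-- On every instance of `n` jobs, the makespan of the algorithm (on its `P` processors) is at
most `c` times the optimal makespan on `p` processors. For `P = p` the algorithm is
`c`-competitive, for `P = s * p` it is `s`-speed `c`-competitive. -/
def IsCompetitive (A : NonClairvoyantAlgorithm n P) (p : ℝ≥0) (c : ℝ) : Prop :=
  ∀ J : Instance n, makespan J (A.schedule J) ≤ ENNReal.ofReal c * opt p J

end NonClairvoyantAlgorithm

/-- A randomized non-clairvoyant algorithm with random seed in `Ω`: a random deterministic
non-clairvoyant algorithm, whose makespan on each instance is a random variable. -/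
structure RandomizedAlgorithm (Ω : Type*) [MeasurableSpace Ω] (n : ℕ) (P : ℝ≥0) where
  run : Ω → NonClairvoyantAlgorithm n P
  measurable_makespan : ∀ J : Instance n, Measurable fun ω => makespan J ((run ω).schedule J)

/-- On every instance of `n` jobs, the expected makespan of the algorithm (on its `P` processors)
is at most `c` times the optimal makespan on `p` processors. -/
def RandomizedAlgorithm.IsCompetitive {Ω : Type*} [MeasurableSpace Ω] {n : ℕ} {P : ℝ≥0}
    (A : RandomizedAlgorithm Ω n P) (μ : Measure Ω) (p : ℝ≥0) (c : ℝ) : Prop :=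
  ∀ J : Instance n,
    ∫⁻ ω, makespan J ((A.run ω).schedule J) ∂μ ≤ ENNReal.ofReal c * opt p J

end Scheduling

end

/-! Equi. Consistent completion times are a fixed point of a monotone map: if jobs end later, shares
shrink and jobs end later still, so Knaster–Tarski applies. Uniqueness is causality
(`eqOn_of_history`): at the first time where two runs complete different jobs, their allotments have
agreed so far, hence also these completions. Upper bound. Let `M` bound the makespan of some
schedule, and let `N(t)` be the number of jobs alive under Equi. The share of a living job never
decreases, so sub-linearity gives (`finishTimeFrom_le_of_cumul_le`): a job ends at most `M` after
the time when Equi has allotted it as much as the schedule did. Thus up to `M` before their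
completions all jobs together receive at most `p * M`, that is, the integral of `N(u + M) / N(u)` is
at most `M`. If some job were alive at `(K + 1) * M`, cutting `[0, K * M)` into `K` windows and
applying AM-GM to the telescoping ratios would give at least `K * n ^ (-1 / K) * M`, which exceeds
`M` when `n < K ^ K`. The least such `K` is asymptotically `ln n / ln ln n`. Lower bound. Jobs have
a random number of parallelizable levels, with growing thresholds `θ i`, and end with a sequential
phase of length 1. Within one time unit the algorithm cannot tell the next level from this final
phase (`finalShare_update`), so processors that would shorten a level are mostly wasted on jobs in
their final phase. With geometric weights `q i` proportional to `1 / θ i`, a job forced to have all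
`K` levels takes time close to `K + 1` on average, while the optimum stays close to 1
(`RandomizedAlgorithm.IsCompetitive.le_add`). The average is over instances that do not depend on
the algorithm, so randomization does not help. -/

namespace Scheduling

/-! ### Integrals of allotments and basic properties of completion times. -/

/-- The integral of `g` between the times `a` and `b`. -/
noncomputable def cumul (g : ℝ≥0 → ℝ≥0) (a b : ℝ≥0) : ℝ≥0∞ :=
  ∫⁻ u in Set.Ico (a : ℝ) (b : ℝ), (g u.toNNReal : ℝ≥0∞)

lemma cumul_add (g : ℝ≥0 → ℝ≥0) {a b c : ℝ≥0} (hab : a ≤ b) (hbc : b ≤ c) :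
    cumul g a b + cumul g b c = cumul g a c := by
  unfold cumul
  rw [← Set.Ico_union_Ico_eq_Ico (NNReal.coe_le_coe.2 hab) (NNReal.coe_le_coe.2 hbc),
    lintegral_union measurableSet_Ico]
  rw [Set.Ico_disjoint_Ico]
  simp [hab, hbc]

lemma cumul_mono {g h : ℝ≥0 → ℝ≥0} {a b : ℝ≥0} (H : ∀ u, a ≤ u → u < b → g u ≤ h u) :
    cumul g a b ≤ cumul h a b := by
  refine setLIntegral_mono' measurableSet_Ico fun u hu => ?_
  have h0 : 0 ≤ u := a.coe_nonneg.trans hu.1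
  exact ENNReal.coe_le_coe.2 (H _ (NNReal.le_toNNReal_of_coe_le hu.1)
    ((Real.toNNReal_lt_iff_lt_coe h0).2 hu.2))

lemma cumul_congr {g h : ℝ≥0 → ℝ≥0} {a b : ℝ≥0} (H : ∀ u, a ≤ u → u < b → g u = h u) :
    cumul g a b = cumul h a b :=
  le_antisymm (cumul_mono fun u h1 h2 => (H u h1 h2).le)
    (cumul_mono fun u h1 h2 => (H u h1 h2).ge)

lemma cumul_const (k a b : ℝ≥0) : cumul (fun _ => k) a b = k * ((b - a : ℝ≥0) : ℝ≥0∞) := by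
  unfold cumul
  rw [setLIntegral_const, Real.volume_Ico, ← ENNReal.ofReal_coe_nnreal (p := b - a),
    NNReal.coe_sub_def, ENNReal.ofReal_max]
  simp

lemma cumul_subset (g : ℝ≥0 → ℝ≥0) {a b a' b' : ℝ≥0} (ha : a' ≤ a) (hb : b ≤ b') :
    cumul g a b ≤ cumul g a' b' :=
  lintegral_mono_set (Set.Ico_subset_Ico (NNReal.coe_le_coe.2 ha) (NNReal.coe_le_coe.2 hb))

lemma cumul_le_of_le {g : ℝ≥0 → ℝ≥0} {k : ℝ≥0} (h : ∀ u, g u ≤ k) (a b : ℝ≥0) :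
    cumul g a b ≤ k * ((b - a : ℝ≥0) : ℝ≥0∞) :=
  (cumul_mono fun u _ _ => h u).trans_eq (cumul_const k a b)

lemma cumul_ne_top {g : ℝ≥0 → ℝ≥0} {k : ℝ≥0} (h : ∀ u, g u ≤ k) (a b : ℝ≥0) :
    cumul g a b ≠ ⊤ :=
  ne_top_of_le_ne_top (ENNReal.mul_ne_top (by simp) (by simp)) (cumul_le_of_le h a b)

lemma sum_cumul_le {ι : Type*} (s : Finset ι) (g : ι → ℝ≥0 → ℝ≥0) (a b : ℝ≥0) :
    ∑ i ∈ s, cumul (g i) a b ≤ cumul (fun u => ∑ i ∈ s, g i u) a b := by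
  classical
  induction s using Finset.induction_on with
  | empty => simp
  | insert i s hi ih =>
    rw [Finset.sum_insert hi]
    refine (add_le_add_right ih _).trans ((le_lintegral_add _ _).trans_eq ?_)
    unfold cumul
    refine lintegral_congr fun u => ?_
    simp only [Finset.sum_insert hi, ENNReal.coe_add]

/-- The rate at which a phase is processed under the allotment `ρ`. -/
noncomputable abbrev Phase.rate (φ : Phase) (ρ : ℝ≥0 → ℝ≥0) : ℝ≥0 → ℝ≥0 :=
  fun u => φ.speedUp (ρ u)

lemma Phase.finishTime_le {φ : Phase} {ρ : ℝ≥0 → ℝ≥0} {t b : ℝ≥0} (h : t ≤ b)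
    (hw : (φ.work : ℝ≥0∞) ≤ cumul (φ.rate ρ) t b) : φ.finishTime ρ t ≤ b :=
  iInf₂_le b ⟨ENNReal.coe_le_coe.2 h, hw⟩

lemma Phase.le_finishTime (φ : Phase) (ρ : ℝ≥0 → ℝ≥0) (t : ℝ≥0∞) : t ≤ φ.finishTime ρ t :=
  le_iInf₂ fun _ h => h.1

lemma Phase.finishTime_mono (φ : Phase) (ρ : ℝ≥0 → ℝ≥0) {t t' : ℝ≥0∞} (h : t ≤ t') :
    φ.finishTime ρ t ≤ φ.finishTime ρ t' := by
  refine le_iInf₂ fun b hb => iInf₂_le b ⟨h.trans hb.1, hb.2.trans (lintegral_mono_set ?_)⟩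
  exact Set.Ico_subset_Ico_left
    (ENNReal.toReal_mono (ne_top_of_le_ne_top ENNReal.coe_ne_top hb.1) h)

lemma Phase.finishTime_anti (φ : Phase) {ρ ρ' : ℝ≥0 → ℝ≥0} (h : ρ ≤ ρ') (t : ℝ≥0∞) :
    φ.finishTime ρ' t ≤ φ.finishTime ρ t := by
  refine le_iInf₂ fun b hb => iInf₂_le b ⟨hb.1, hb.2.trans (lintegral_mono fun u => ?_)⟩
  exact ENNReal.coe_le_coe.2 (φ.monotone_speedUp (h _))

/-- The infimum defining the finish time is attained: the rate is at most `φ.speedUp P`, so only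
little work is done shortly after `b`. -/
lemma Phase.finishTime_le_iff {φ : Phase} {ρ : ℝ≥0 → ℝ≥0} {P : ℝ≥0} (hρ : ∀ u, ρ u ≤ P)
    {t b : ℝ≥0} :
    φ.finishTime ρ t ≤ b ↔ t ≤ b ∧ (φ.work : ℝ≥0∞) ≤ cumul (φ.rate ρ) t b := by
  refine ⟨fun h => ?_, fun h => finishTime_le h.1 h.2⟩
  have htb : t ≤ b := ENNReal.coe_le_coe.1 ((φ.le_finishTime ρ t).trans h)
  refine ⟨htb, ENNReal.le_of_forall_pos_le_add fun ε hε _ => ?_⟩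
  set G := φ.speedUp P with hG
  have hlt : φ.finishTime ρ t < ((b + ε / (G + 1) : ℝ≥0) : ℝ≥0∞) :=
    h.trans_lt (ENNReal.coe_lt_coe.2 (lt_add_of_pos_right _ (by positivity)))
  obtain ⟨b', hb'⟩ := iInf_lt_iff.1 hlt
  obtain ⟨hb, hlt'⟩ := iInf_lt_iff.1 hb'
  have hb1 : b' ≤ b + ε / (G + 1) := (ENNReal.coe_lt_coe.1 hlt').le
  refine hb.2.trans ((cumul_subset (φ.rate ρ) (le_refl t) hb1).trans ?_)
  rw [← cumul_add _ htb (le_add_of_nonneg_right zero_le)]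
  gcongr
  refine (cumul_le_of_le (fun u => φ.monotone_speedUp (hρ u)) _ _).trans ?_
  rw [← ENNReal.coe_mul, add_tsub_cancel_left, ENNReal.coe_le_coe, ← hG]
  calc G * (ε / (G + 1)) ≤ (G + 1) * (ε / (G + 1)) := by gcongr; simp
    _ = ε := mul_div_cancel₀ _ (by positivity)

lemma Phase.finishTime_congr {φ : Phase} {ρ ρ' : ℝ≥0 → ℝ≥0} {P : ℝ≥0} (hρ : ∀ u, ρ u ≤ P)
    (hρ' : ∀ u, ρ' u ≤ P) {t : ℝ≥0∞} {b : ℝ≥0} (h : ∀ u < b, ρ u = ρ' u)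
    (hb : φ.finishTime ρ t ≤ b) : φ.finishTime ρ' t = φ.finishTime ρ t := by
  have key : ∀ {ρ ρ' : ℝ≥0 → ℝ≥0}, (∀ u, ρ u ≤ P) → (∀ u, ρ' u ≤ P) → (∀ u < b, ρ u = ρ' u) →
      φ.finishTime ρ t ≤ b → φ.finishTime ρ' t ≤ φ.finishTime ρ t := by
    intro ρ ρ' hρ hρ' h hb
    lift t to ℝ≥0 using ne_top_of_le_ne_top ENNReal.coe_ne_top ((φ.le_finishTime ρ t).trans hb)
    obtain ⟨f, hf⟩ : ∃ f : ℝ≥0, (f : ℝ≥0∞) = φ.finishTime ρ t :=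
      ⟨_, ENNReal.coe_toNNReal (ne_top_of_le_ne_top ENNReal.coe_ne_top hb)⟩
    rw [← hf, ENNReal.coe_le_coe] at hb
    have hf' := (finishTime_le_iff hρ).1 hf.ge
    rw [← hf]
    refine finishTime_le hf'.1 (hf'.2.trans_eq (cumul_congr fun u _ hu => ?_))
    simp only [Phase.rate, h u (hu.trans_le hb)]
  have h1 := key hρ hρ' h hb
  exact le_antisymm h1 (key hρ' hρ (fun u hu => (h u hu).symm) (h1.trans hb))

lemma le_finishTimeFrom (ρ : ℝ≥0 → ℝ≥0) (L : List Phase) (t : ℝ≥0∞) :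
    t ≤ finishTimeFrom ρ L t := by
  induction L generalizing t with
  | nil => exact le_rfl
  | cons φ L ih => exact (φ.le_finishTime ρ t).trans (ih _)

lemma finishTimeFrom_mono (ρ : ℝ≥0 → ℝ≥0) (L : List Phase) {t t' : ℝ≥0∞} (h : t ≤ t') :
    finishTimeFrom ρ L t ≤ finishTimeFrom ρ L t' := by
  induction L generalizing t t' with
  | nil => exact h
  | cons φ L ih => exact ih (φ.finishTime_mono ρ h)

lemma finishTimeFrom_anti {ρ ρ' : ℝ≥0 → ℝ≥0} (h : ρ ≤ ρ') (L : List Phase) (t : ℝ≥0∞) :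
    finishTimeFrom ρ' L t ≤ finishTimeFrom ρ L t := by
  induction L generalizing t with
  | nil => exact le_rfl
  | cons φ L ih => exact (finishTimeFrom_mono _ _ (φ.finishTime_anti h t)).trans (ih _)

lemma finishTimeFrom_append (ρ : ℝ≥0 → ℝ≥0) (L L' : List Phase) (t : ℝ≥0∞) :
    finishTimeFrom ρ (L ++ L') t = finishTimeFrom ρ L' (finishTimeFrom ρ L t) := by
  induction L generalizing t with
  | nil => rfl
  | cons φ L ih => exact ih _

/-- `T = ⊤` is allowed, so that jobs that are never completed are covered as well. -/
lemma finishTimeFrom_congr {ρ ρ' : ℝ≥0 → ℝ≥0} {P : ℝ≥0} (hρ : ∀ u, ρ u ≤ P)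
    (hρ' : ∀ u, ρ' u ≤ P) {L : List Phase} {t T : ℝ≥0∞}
    (h : ∀ u : ℝ≥0, (u : ℝ≥0∞) < T → ρ u = ρ' u)
    (hT : finishTimeFrom ρ L t ≤ T) : finishTimeFrom ρ' L t = finishTimeFrom ρ L t := by
  induction T with
  | top =>
    have : ρ = ρ' := funext fun u => h u ENNReal.coe_lt_top
    rw [this]
  | coe b =>
    induction L generalizing t with
    | nil => rfl
    | cons φ L ih =>
      have h1 : φ.finishTime ρ' t = φ.finishTime ρ t :=
        Phase.finishTime_congr hρ hρ' (fun u hu => h u (ENNReal.coe_lt_coe.2 hu))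
          ((le_finishTimeFrom ρ L _).trans hT)
      simp only [finishTimeFrom] at hT ⊢
      rw [h1, ih hT]

lemma completionTime_congr {ρ ρ' : ℝ≥0 → ℝ≥0} {P : ℝ≥0} (hρ : ∀ u, ρ u ≤ P)
    (hρ' : ∀ u, ρ' u ≤ P) {J : Job} {T : ℝ≥0∞}
    (h : ∀ u : ℝ≥0, (u : ℝ≥0∞) < T → ρ u = ρ' u)
    (hT : completionTime J ρ ≤ T) : completionTime J ρ' = completionTime J ρ :=
  finishTimeFrom_congr hρ hρ' h hT

lemma IsSchedule.le {n : ℕ} {P : ℝ≥0} {ρ : Fin n → ℝ≥0 → ℝ≥0} (h : IsSchedule P ρ)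
    (j : Fin n) (u : ℝ≥0) : ρ j u ≤ P :=
  (Finset.single_le_sum (f := fun j => ρ j u) (fun _ _ => zero_le) (Finset.mem_univ j)).trans
    (h.2 u)

/-! ### Causality of non-clairvoyant allotments. -/

/-- Two allotments that depend only on the completions agree as long as the completion times
that the jobs of the two instances have under the first allotment do. -/
lemma eqOn_of_history {n : ℕ} {P : ℝ≥0} {ρ ρ' : Fin n → ℝ≥0 → ℝ≥0} (hρ : ∀ j u, ρ j u ≤ P)
    (hρ' : ∀ j u, ρ' j u ≤ P) {J J' : Instance n} {T : ℝ≥0∞}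
    (hT : ∀ j, min (completionTime (J' j) (ρ j)) T = min (completionTime (J j) (ρ j)) T)
    (hist : ∀ t : ℝ≥0, (∀ (j : Fin n) (u : ℝ≥0), u ≤ t →
      (completionTime (J j) (ρ j) ≤ u ↔ completionTime (J' j) (ρ' j) ≤ u)) →
      ∀ j, ρ j t = ρ' j t) {u : ℝ≥0} (hu : (u : ℝ≥0∞) < T) (j : Fin n) : ρ j u = ρ' j u := by
  set c := fun j => completionTime (J j) (ρ j) with hc
  set c' := fun j => completionTime (J' j) (ρ' j) with hc'
  have hle : ∀ (a b : ℝ≥0∞) (v : ℝ≥0), (v : ℝ≥0∞) < T → min a T = min b T → (a ≤ v ↔ b ≤ v) := by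
    intro a b v hv hab
    have h1 : ∀ x : ℝ≥0∞, x ≤ v ↔ min x T ≤ v := fun x => by simp [hv.not_ge]
    rw [h1, hab, ← h1]
  have hagree : ∀ m : ℝ≥0∞, m ≤ T → (∀ i, min (c i) T ≠ min (c' i) T → m ≤ min (c i) (c' i)) →
      ∀ v : ℝ≥0, (v : ℝ≥0∞) < m → ∀ i, ρ i v = ρ' i v := by
    intro m hm H v hv
    refine hist v fun i w hw => ?_
    have hwm : (w : ℝ≥0∞) < m := (ENNReal.coe_le_coe.2 hw).trans_lt hv
    by_cases hi : min (c i) T = min (c' i) T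
    · exact hle _ _ w (hwm.trans_le hm) hi
    · have := lt_min_iff.1 (hwm.trans_le (H i hi))
      exact iff_of_false this.1.not_ge this.2.not_ge
  -- Among the jobs whose truncated completion times differ, take one where the earlier of the two
  -- is least. Before that time the allotments agree, so the two completion times cannot differ
  -- there.
  have hall : ∀ i, min (c i) T = min (c' i) T := by
    by_contra! hne
    obtain ⟨i₀, hi₀⟩ := hne
    obtain ⟨i, hi, hmin⟩ := Finset.exists_min_image
      (Finset.univ.filter fun i => min (c i) T ≠ min (c' i) T) (fun i => min (c i) (c' i))
      ⟨i₀, by simpa using hi₀⟩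
    replace hi : min (c i) T ≠ min (c' i) T := by simpa using hi
    have hmT : min (c i) (c' i) ≤ T := by
      by_contra! h
      rw [lt_min_iff] at h
      exact hi (by rw [min_eq_right h.1.le, min_eq_right h.2.le])
    have hag := hagree _ hmT fun k hk => hmin k (by simpa using hk)
    rcases le_total (c i) (c' i) with h | h
    · rw [min_eq_left h] at hmT hag
      have h1 : min (completionTime (J' i) (ρ i)) T = c i := (hT i).trans (min_eq_left hmT)
      have h2 : c i ≤ completionTime (J' i) (ρ i) := h1 ▸ min_le_left _ _
      have h4 : min (completionTime (J' i) (ρ' i)) T = min (completionTime (J' i) (ρ i)) T := by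
        rcases le_or_gt (completionTime (J' i) (ρ i)) (c i) with h3 | h3
        · rw [completionTime_congr (hρ i) (hρ' i) (fun v hv => hag v hv i) h3]
        -- By `hT`, the job of `J'` can outlast `c i` under `ρ` only if the truncation takes place
        -- exactly there.
        · have hTc : T = c i := (min_choice _ _).elim (fun h => absurd (h.symm.trans h1) h3.ne')
            fun h => h.symm.trans h1
          rw [hTc, min_eq_right h, min_eq_right h2]
      exact hi ((hT i).symm.trans h4.symm)
    · rw [min_eq_right h] at hmT hag
      have h1 := completionTime_congr (hρ' i) (hρ i) (fun v hv => (hag v hv i).symm)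
        (le_refl (c' i))
      exact hi ((hT i).symm.trans (by rw [h1]))
  exact hagree T le_rfl (fun i hi => absurd (hall i) hi) u hu j

/-- The hypothesis runs both instances under the allotment made for `J`, so it can be checked
without knowing how the algorithm treats `J'`. -/
lemma NonClairvoyantAlgorithm.schedule_eqOn {n : ℕ} {P : ℝ≥0} (A : NonClairvoyantAlgorithm n P)
    {J J' : Instance n} {T : ℝ≥0∞}
    (hT : ∀ j, min (completionTime (J' j) (A.schedule J j)) T =
      min (completionTime (J j) (A.schedule J j)) T) {u : ℝ≥0} (hu : (u : ℝ≥0∞) < T)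
    (j : Fin n) : A.schedule J j u = A.schedule J' j u :=
  eqOn_of_history (fun j => (A.isSchedule J).le j) (fun j => (A.isSchedule J').le j) hT
    (fun t h => A.nonClairvoyant J J' t h) hu j

/-! ### Existence and uniqueness of Equi. -/

/-- The number of jobs that are not completed at time `t`, for given completion times. -/
noncomputable def numAlive {n : ℕ} (c : Fin n → ℝ≥0∞) (t : ℝ≥0) : ℕ :=
  (Finset.univ.filter fun i => (t : ℝ≥0∞) < c i).card

lemma numAlive_mono {n : ℕ} {c c' : Fin n → ℝ≥0∞} (h : c ≤ c') (t : ℝ≥0) :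
    numAlive c t ≤ numAlive c' t :=
  Finset.card_le_card (Finset.monotone_filter_right _ fun i _ hi => hi.trans_le (h i))

lemma numAlive_anti {n : ℕ} (c : Fin n → ℝ≥0∞) : Antitone (numAlive c) := fun _ _ h =>
  Finset.card_le_card (Finset.monotone_filter_right _ fun _ _ hi =>
    (ENNReal.coe_le_coe.2 h).trans_lt hi)

lemma numAlive_le {n : ℕ} (c : Fin n → ℝ≥0∞) (t : ℝ≥0) : numAlive c t ≤ n :=
  (Finset.card_le_univ _).trans_eq (Fintype.card_fin n)

lemma one_le_numAlive {n : ℕ} {c : Fin n → ℝ≥0∞} {t : ℝ≥0} {j : Fin n}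
    (h : (t : ℝ≥0∞) < c j) : 1 ≤ numAlive c t :=
  Finset.card_pos.2 ⟨j, by simpa using h⟩

/-- The share of an uncompleted job when `p` processors are split evenly. -/
noncomputable def equiShare {n : ℕ} (p : ℝ≥0) (c : Fin n → ℝ≥0∞) (t : ℝ≥0) : ℝ≥0 :=
  p / (max (numAlive c t) 1 : ℕ)

lemma equiShare_le {n : ℕ} (p : ℝ≥0) (c : Fin n → ℝ≥0∞) (t : ℝ≥0) : equiShare p c t ≤ p :=
  div_le_self zero_le (by exact_mod_cast le_max_right _ _)

lemma equiShare_monotone {n : ℕ} (p : ℝ≥0) (c : Fin n → ℝ≥0∞) : Monotone (equiShare p c) := by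
  intro s t h
  unfold equiShare
  have := numAlive_anti c h
  gcongr

lemma equiShare_anti {n : ℕ} (p : ℝ≥0) {c c' : Fin n → ℝ≥0∞} (h : c ≤ c') :
    equiShare p c' ≤ equiShare p c := by
  intro t
  unfold equiShare
  have := numAlive_mono h t
  gcongr

/-- The allotment of Equi for given completion times. -/
noncomputable def equiAllotment {n : ℕ} (p : ℝ≥0) (c : Fin n → ℝ≥0∞) (j : Fin n) (t : ℝ≥0) :
    ℝ≥0 :=
  if (t : ℝ≥0∞) < c j then equiShare p c t else 0

lemma equiAllotment_le {n : ℕ} (p : ℝ≥0) (c : Fin n → ℝ≥0∞) (j : Fin n) (t : ℝ≥0) :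
    equiAllotment p c j t ≤ p := by
  unfold equiAllotment
  split_ifs
  exacts [equiShare_le p c t, zero_le]

lemma isSchedule_equiAllotment {n : ℕ} (p : ℝ≥0) (c : Fin n → ℝ≥0∞) :
    IsSchedule p (equiAllotment p c) := by
  refine ⟨fun j T => ⟨Finset.univ.image fun i => (c i).toNNReal, fun a b hab _ hF => ?_⟩,
    fun t => ?_⟩
  · have h : ∀ i, (a : ℝ≥0∞) < c i ↔ (b : ℝ≥0∞) < c i := by
      intro i
      refine ⟨fun h => ?_, fun h => (ENNReal.coe_le_coe.2 hab).trans_lt h⟩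
      by_contra! hb
      refine hF (c i).toNNReal (Finset.mem_image_of_mem _ (Finset.mem_univ i)) ?_
      obtain ⟨x, hx⟩ : ∃ x : ℝ≥0, (x : ℝ≥0∞) = c i :=
        ⟨_, ENNReal.coe_toNNReal (ne_top_of_le_ne_top ENNReal.coe_ne_top hb)⟩
      rw [← hx, ENNReal.coe_lt_coe] at h
      rw [← hx, ENNReal.coe_le_coe] at hb
      rw [← hx, ENNReal.toNNReal_coe]
      exact ⟨h.le, hb⟩
    simp only [equiAllotment, equiShare, numAlive, h]
  · simp only [equiAllotment]
    rw [← Finset.sum_filter, Finset.sum_const, nsmul_eq_mul]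
    change (numAlive c t : ℝ≥0) * (p / _) ≤ p
    calc (numAlive c t : ℝ≥0) * (p / (max (numAlive c t) 1 : ℕ))
        ≤ (max (numAlive c t) 1 : ℕ) * (p / (max (numAlive c t) 1 : ℕ)) := by
          gcongr
          exact le_max_left _ _
      _ = p := mul_div_cancel₀ _ (by
          have := le_max_right (numAlive c t) 1
          positivity)

/-- What a job would receive after its completion is irrelevant, so the share may be left on
forever. -/
lemma completionTime_equiAllotment {n : ℕ} (p : ℝ≥0) {J : Job} (c : Fin n → ℝ≥0∞) {j : Fin n}
    (h : completionTime J (equiShare p c) = c j) :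
    completionTime J (equiAllotment p c j) = c j := by
  refine (completionTime_congr (equiShare_le p c) (equiAllotment_le p c j) (fun u hu => ?_)
    h.le).trans h
  exact (if_pos hu).symm

/-- Completion times that are consistent with an even split exist for every instance. -/
lemma exists_equi_completionTimes {n : ℕ} (p : ℝ≥0) (J : Instance n) :
    ∃ c : Fin n → ℝ≥0∞, ∀ j, completionTime (J j) (equiAllotment p c j) = c j := by
  -- The fixed point is taken for `equiShare`, which is antitone in `c`; `equiAllotment` is not,
  -- because of its cut-off at `c j`.
  let F : (Fin n → ℝ≥0∞) →o (Fin n → ℝ≥0∞) :=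
    ⟨fun c j => completionTime (J j) (equiShare p c), fun c c' h j =>
      finishTimeFrom_anti (equiShare_anti p h) _ _⟩
  exact ⟨F.lfp, fun j => completionTime_equiAllotment p _ (congrFun F.map_lfp j)⟩

lemma NonClairvoyantAlgorithm.IsEqui.schedule_eq {n : ℕ} {p : ℝ≥0}
    {A : NonClairvoyantAlgorithm n p} (hA : A.IsEqui) (J : Instance n) (j : Fin n) :
    A.schedule J j = equiAllotment p (fun i => completionTime (J i) (A.schedule J i)) j := by
  ext1 t
  obtain ⟨h1, h2⟩ := hA J t j
  unfold equiAllotment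
  split_ifs with h
  · rw [h1 h, equiShare]
    have hN : (A.uncompleted J t).ncard
        = numAlive (fun i => completionTime (J i) (A.schedule J i)) t := by
      rw [numAlive, ← Set.ncard_coe_finset]
      simp [uncompleted]
    rw [hN, max_eq_left (one_le_numAlive h)]
  · exact h2 h

theorem existsUnique_isEqui (n : ℕ) (p : ℝ≥0) :
    ∃! A : NonClairvoyantAlgorithm n p, A.IsEqui := by
  choose c hc using exists_equi_completionTimes (n := n) p
  have hequi : ∀ J (t : ℝ≥0), (∀ J', (∀ (j : Fin n) (u : ℝ≥0), u ≤ t →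
      (completionTime (J j) (equiAllotment p (c J) j) ≤ u ↔
        completionTime (J' j) (equiAllotment p (c J') j) ≤ u)) →
      ∀ j, equiAllotment p (c J) j t = equiAllotment p (c J') j t) := by
    intro J t J' h j
    have h' : ∀ i, (t : ℝ≥0∞) < c J i ↔ (t : ℝ≥0∞) < c J' i := fun i => by
      have := h i t le_rfl
      rw [hc, hc] at this
      rw [← not_le, this, not_le]
    simp only [equiAllotment, equiShare, numAlive, h']
  let A : NonClairvoyantAlgorithm n p :=
    ⟨fun J => equiAllotment p (c J), fun J => isSchedule_equiAllotment p _,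
      fun J J' t h => hequi J t J' h⟩
  have hA : A.IsEqui := by
    intro J t j
    have hU : A.uncompleted J t = {i | (t : ℝ≥0∞) < c J i} := by
      ext i
      simp only [NonClairvoyantAlgorithm.uncompleted, Set.mem_ofPred_eq]
      rw [← hc J i]
    rw [hU]
    refine ⟨fun hj => ?_, fun hj => if_neg hj⟩
    have hN : ({i | (t : ℝ≥0∞) < c J i} : Set (Fin n)).ncard = numAlive (c J) t := by
      rw [numAlive, ← Set.ncard_coe_finset]
      simp
    rw [hN]
    replace hj : (t : ℝ≥0∞) < c J j := hj
    change equiAllotment p (c J) j t = _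
    rw [equiAllotment, if_pos hj, equiShare, max_eq_left (one_le_numAlive hj)]
  refine ⟨A, hA, fun B hB => ?_⟩
  have hsched : B.schedule = A.schedule := by
    funext J j u
    refine eqOn_of_history (T := ⊤) (J := J) (J' := J) (fun j => (B.isSchedule J).le j)
      (fun j => (A.isSchedule J).le j) (fun _ => rfl) (fun t h i => ?_) ENNReal.coe_lt_top j
    rw [hB.schedule_eq, hA.schedule_eq]
    have h' : ∀ i, (t : ℝ≥0∞) < completionTime (J i) (B.schedule J i) ↔
        (t : ℝ≥0∞) < completionTime (J i) (A.schedule J i) := fun i => by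
      rw [← not_le, h i t le_rfl, not_le]
    simp only [equiAllotment, equiShare, numAlive, h']
  cases B
  congr

/-! ### Upper bound for Equi when `n < K ^ K`. -/

lemma cumul_const_mul (k : ℝ≥0) (g : ℝ≥0 → ℝ≥0) (a b : ℝ≥0) :
    cumul (fun u => k * g u) a b = k * cumul g a b := by
  unfold cumul
  rw [← lintegral_const_mul' _ _ ENNReal.coe_ne_top]
  simp only [ENNReal.coe_mul]

lemma cumul_const_add (k : ℝ≥0) (g : ℝ≥0 → ℝ≥0) (a b : ℝ≥0) :
    cumul (fun u => k + g u) a b = k * ((b - a : ℝ≥0) : ℝ≥0∞) + cumul g a b := by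
  rw [← cumul_const]
  unfold cumul
  rw [← lintegral_add_left measurable_const]
  simp only [ENNReal.coe_add]

lemma cumul_sum {ι : Type*} (s : Finset ι) {g : ι → ℝ≥0 → ℝ≥0} (hg : ∀ i, Measurable (g i))
    (a b : ℝ≥0) : cumul (fun u => ∑ i ∈ s, g i u) a b = ∑ i ∈ s, cumul (g i) a b := by
  unfold cumul
  rw [← lintegral_finsetSum s (f := fun i (u : ℝ) => (g i u.toNNReal : ℝ≥0∞))
    fun i _ => ((hg i).comp measurable_real_toNNReal).coe_nnreal_ennreal]
  simp

lemma cumul_shift (g : ℝ≥0 → ℝ≥0) (a b s : ℝ≥0) :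
    cumul g (a + s) (b + s) = cumul (fun u => g (u + s)) a b := by
  unfold cumul
  have h := (measurePreserving_add_right volume (s : ℝ)).setLIntegral_comp_preimage_emb
    (MeasurableEquiv.addRight (s : ℝ)).measurableEmbedding
    (fun u : ℝ => (g u.toNNReal : ℝ≥0∞)) (Set.Ico ((a + s : ℝ≥0) : ℝ) ((b + s : ℝ≥0) : ℝ))
  rw [← h]
  have hset : (fun x : ℝ => x + s) ⁻¹' Set.Ico ((a + s : ℝ≥0) : ℝ) ((b + s : ℝ≥0) : ℝ)
      = Set.Ico (a : ℝ) b := by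
    simp
  rw [hset]
  refine setLIntegral_congr_fun measurableSet_Ico fun u hu => ?_
  have h0 : 0 ≤ u := a.coe_nonneg.trans hu.1
  simp [Real.toNNReal_add h0 s.coe_nonneg]

/-- Intermediate value theorem for the integral of a bounded function. -/
lemma exists_cumul_eq {r : ℝ≥0 → ℝ≥0} {P : ℝ≥0} (hP : ∀ u, r u ≤ P) {x y : ℝ≥0} (hxy : x ≤ y)
    {W : ℝ≥0∞} (hW : W ≤ cumul r x y) : ∃ z, x ≤ z ∧ z ≤ y ∧ cumul r x z = W := by
  have hfin : ∀ a b, cumul r a b ≠ ⊤ := cumul_ne_top hP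
  have hlip : LipschitzWith P fun z => (cumul r x z).toReal := by
    refine LipschitzWith.of_le_add_mul P fun z z' => ?_
    have h1 : cumul r x z ≤ cumul r x z' + cumul r z' z := by
      refine le_trans (lintegral_mono_set ?_) (lintegral_union_le _ _ _)
      exact Set.Ico_subset_Ico_union_Ico
    have h2 : cumul r z' z ≤ (P : ℝ≥0∞) * ((nndist z z' : ℝ≥0) : ℝ≥0∞) := by
      refine (cumul_le_of_le hP _ _).trans ?_
      gcongr
      rw [NNReal.nndist_eq]
      exact le_max_left _ _
    have h3 := ENNReal.toReal_mono (ENNReal.add_ne_top.2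
      ⟨hfin _ _, by finiteness⟩) (h1.trans (add_le_add_right h2 _))
    rwa [ENNReal.toReal_add (hfin _ _) (by finiteness), ENNReal.toReal_mul] at h3
  have h0 : cumul r x x = 0 := by simp [cumul]
  have hWt : W ≠ ⊤ := ne_top_of_le_ne_top (hfin _ _) hW
  obtain ⟨z, hz, hzW⟩ := intermediate_value_Icc hxy hlip.continuous.continuousOn
    (show W.toReal ∈ Set.Icc _ _ from
      ⟨by simp [h0], ENNReal.toReal_mono (hfin _ _) hW⟩)
  exact ⟨z, hz.1, hz.2, (ENNReal.toReal_eq_toReal_iff' (hfin _ _) hWt).1 hzW⟩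

lemma Phase.speedUp_mul_le (φ : Phase) {ρ σ : ℝ≥0} (h : ρ ≤ σ) (hσ : 0 < σ) :
    φ.speedUp σ / σ * ρ ≤ φ.speedUp ρ := by
  rcases eq_or_ne ρ 0 with rfl | h0
  · simp
  rcases h.eq_or_lt with rfl | hlt
  · rw [div_mul_cancel₀ _ h0]
  · calc φ.speedUp σ / σ * ρ ≤ φ.speedUp ρ / ρ * ρ := by
          exact mul_le_mul_left (φ.sublinear_speedUp _ _ (pos_iff_ne_zero.2 h0) hlt) _
      _ = φ.speedUp ρ := div_mul_cancel₀ _ h0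

/-- Monotonicity gives the bound below `σ`, sub-linearity above. Together with
`Phase.speedUp_mul_le` it compares two allotments through the single value at `σ`. -/
lemma Phase.speedUp_le_add (φ : Phase) {σ : ℝ≥0} (hσ : 0 < σ) (ρ : ℝ≥0) :
    φ.speedUp ρ ≤ φ.speedUp σ + φ.speedUp σ / σ * ρ := by
  rcases le_or_gt ρ σ with h | h
  · exact (φ.monotone_speedUp h).trans (le_add_of_nonneg_right zero_le)
  · have hρ := hσ.trans h
    calc φ.speedUp ρ = φ.speedUp ρ / ρ * ρ := (div_mul_cancel₀ _ hρ.ne').symm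
      _ ≤ φ.speedUp σ / σ * ρ := by
          exact mul_le_mul_left (φ.sublinear_speedUp _ _ hσ h) _
      _ ≤ _ := le_add_of_nonneg_left zero_le

/-- If a phase takes time `f - s` under `ρ` and `r` is non-decreasing, then the phase takes at most
this time longer under `r` than `r` needs to allot as much as `ρ` did. -/
lemma Phase.finishTime_le_of_cumul_le (φ : Phase) {r ρ : ℝ≥0 → ℝ≥0} (hr : Monotone r)
    {a b s f : ℝ≥0} (hab : a ≤ b) (hpos : 0 < r b)
    (hw : (φ.work : ℝ≥0∞) ≤ cumul (φ.rate ρ) s f) (hle : cumul ρ s f ≤ cumul r a b) :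
    φ.finishTime r a ≤ ((b + (f - s) : ℝ≥0) : ℝ≥0∞) := by
  refine Phase.finishTime_le (hab.trans (le_add_of_nonneg_right zero_le)) (hw.trans ?_)
  -- The work done under `ρ` is charged at `G` per unit of time, which `r` makes up for after `b`,
  -- and at `G / r b` per unit of processor time, which `r` makes up for before `b`.
  set G := φ.speedUp (r b)
  calc cumul (φ.rate ρ) s f ≤ cumul (fun u => G + G / r b * ρ u) s f :=
        cumul_mono fun u _ _ => φ.speedUp_le_add hpos _
    _ = G * ((f - s : ℝ≥0) : ℝ≥0∞) + (G / r b : ℝ≥0) * cumul ρ s f := by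
        rw [cumul_const_add, cumul_const_mul]
    _ ≤ cumul (fun _ => G) b (b + (f - s)) + (G / r b : ℝ≥0) * cumul r a b := by
        rw [cumul_const, add_tsub_cancel_left]
        gcongr
    _ = cumul (fun u => G / r b * r u) a b + cumul (fun _ => G) b (b + (f - s)) := by
        rw [cumul_const_mul, add_comm]
    _ ≤ cumul (φ.rate r) a b + cumul (φ.rate r) b (b + (f - s)) := by
        gcongr
        · exact cumul_mono fun u _ hu => φ.speedUp_mul_le (hr hu.le) hpos
        · exact cumul_mono fun u hu _ => φ.monotone_speedUp (hr hu)
    _ = cumul (φ.rate r) a (b + (f - s)) := cumul_add _ hab (le_add_of_nonneg_right zero_le)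

lemma cumul_le_shift {r : ℝ≥0 → ℝ≥0} (hr : Monotone r) (x y s : ℝ≥0) :
    cumul r x y ≤ cumul r (x + s) (y + s) := by
  rw [cumul_shift]
  exact cumul_mono fun u _ _ => hr (le_add_of_nonneg_right zero_le)

/-- A job that is completed at time `M` under `ρ` is delayed under a non-decreasing allotment `r`
at most by the time that `r` needs to allot as much as `ρ` did. -/
lemma finishTimeFrom_le_of_cumul_le {r ρ : ℝ≥0 → ℝ≥0} {P : ℝ≥0} (hr : Monotone r)
    (hpos : ∀ u, 0 < r u) (hrP : ∀ u, r u ≤ P) (hρP : ∀ u, ρ u ≤ P) {L : List Phase}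
    {x y s M : ℝ≥0} (hxy : x ≤ y) (hM : finishTimeFrom ρ L s ≤ M)
    (h : cumul ρ s M ≤ cumul r x y) :
    finishTimeFrom r L ((x + s : ℝ≥0) : ℝ≥0∞) ≤ ((y + M : ℝ≥0) : ℝ≥0∞) := by
  induction L generalizing x s with
  | nil => exact ENNReal.coe_le_coe.2 (add_le_add hxy (ENNReal.coe_le_coe.1 hM))
  | cons φ L ih =>
    obtain ⟨f, hf⟩ : ∃ f : ℝ≥0, (f : ℝ≥0∞) = φ.finishTime ρ s :=
      ⟨_, ENNReal.coe_toNNReal (ne_top_of_le_ne_top ENNReal.coe_ne_top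
        ((le_finishTimeFrom ρ L _).trans hM))⟩
    obtain ⟨hsf, hw⟩ := (Phase.finishTime_le_iff hρP).1 hf.ge
    simp only [finishTimeFrom] at hM ⊢
    rw [← hf] at hM
    have hfM : f ≤ M := ENNReal.coe_le_coe.1 ((le_finishTimeFrom ρ L _).trans hM)
    -- At `z` the allotment `r` has given as much as `ρ` gave to this phase; the induction goes on
    -- from `z` and `f`.
    obtain ⟨z, hxz, hzy, hz⟩ := exists_cumul_eq hrP hxy
      ((cumul_subset ρ (le_refl s) hfM).trans h)
    have h1 : φ.finishTime r ((x + s : ℝ≥0) : ℝ≥0∞) ≤ ((z + f : ℝ≥0) : ℝ≥0∞) := by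
      have := φ.finishTime_le_of_cumul_le hr (add_le_add_left hxz s) (hpos _) hw
        (hz.symm.le.trans (cumul_le_shift hr x z s))
      rwa [add_assoc, add_tsub_cancel_of_le hsf] at this
    refine (finishTimeFrom_mono r L h1).trans (ih hzy hM ?_)
    rw [← cumul_add ρ hsf hfM, ← cumul_add r hxz hzy, hz] at h
    exact (ENNReal.add_le_add_iff_left (cumul_ne_top hρP _ _)).1 h

/-- Arithmetic-geometric mean inequality for the ratios of successive terms of a sequence. -/
lemma le_sum_ratio {K : ℕ} (hK : 0 < K) (N : ℕ → ℕ) {n : ℕ} (h0 : N 0 ≤ n)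
    (hpos : ∀ i ≤ K, 1 ≤ N i) :
    (K : ℝ≥0) * (1 / n : ℝ≥0) ^ (1 / K : ℝ) ≤ ∑ i ∈ Finset.range K, (N (i + 1) / N i : ℝ≥0) := by
  have hK' : (K : ℝ≥0) ≠ 0 := by exact_mod_cast hK.ne'
  have hprod : ∀ m ≤ K, ∏ i ∈ Finset.range m, (N (i + 1) / N i : ℝ≥0) = N m / N 0 := by
    intro m hm
    induction m with
    | zero =>
      have : (N 0 : ℝ≥0) ≠ 0 := by exact_mod_cast Nat.one_le_iff_ne_zero.1 (hpos 0 hm)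
      simp [this]
    | succ m ih =>
      have : (N m : ℝ≥0) ≠ 0 := by exact_mod_cast Nat.one_le_iff_ne_zero.1 (hpos m (by omega))
      rw [Finset.prod_range_succ, ih (by omega)]
      field_simp
  have hge : (1 / n : ℝ≥0) ≤ ∏ i ∈ Finset.range K, (N (i + 1) / N i : ℝ≥0) := by
    rw [hprod K le_rfl]
    have h1 : 0 < (N 0 : ℝ≥0) := by exact_mod_cast hpos 0 (Nat.zero_le _)
    gcongr
    exact_mod_cast hpos K le_rfl
  have amgm := NNReal.geom_mean_le_arith_mean_weighted (Finset.range K)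
    (fun _ => 1 / (K : ℝ≥0)) (fun i => (N (i + 1) / N i : ℝ≥0)) (by simp [hK'])
  rw [← Finset.mul_sum, NNReal.finsetProd_rpow] at amgm
  have h2 : (1 / n : ℝ≥0) ^ (1 / K : ℝ)
      ≤ 1 / K * ∑ i ∈ Finset.range K, (N (i + 1) / N i : ℝ≥0) := by
    refine le_trans ?_ amgm
    push_cast
    exact NNReal.rpow_le_rpow hge (by positivity)
  calc _ ≤ (K : ℝ≥0) * (1 / K * ∑ i ∈ Finset.range K, (N (i + 1) / N i : ℝ≥0)) := by gcongr
    _ = _ := by rw [← mul_assoc, mul_one_div_cancel hK', one_mul]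

lemma cumul_self (g : ℝ≥0 → ℝ≥0) (a : ℝ≥0) : cumul g a a = 0 := by simp [cumul]

lemma sum_cumul_consecutive (g : ℝ≥0 → ℝ≥0) (M : ℝ≥0) (K : ℕ) :
    ∑ i ∈ Finset.range K, cumul (fun u => g (u + i * M)) 0 M = cumul g 0 (K * M) := by
  induction K with
  | zero => simp [cumul_self]
  | succ K ih =>
    rw [Finset.sum_range_succ, ih, ← cumul_shift, zero_add]
    have h : M + K * M = ((K + 1 : ℕ) : ℝ≥0) * M := by push_cast; ring
    rw [h]
    exact cumul_add g zero_le (by gcongr; simp)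

/-- Otherwise the share would have matched the whole allotment of `ρ` by some `z` with `z + M < c
j`, and `finishTimeFrom_le_of_cumul_le` would complete the job by `z + M`. -/
lemma cumul_equiShare_le {n : ℕ} {p : ℝ≥0} (hp : 0 < p) {J : Job} {c : Fin n → ℝ≥0∞} {j : Fin n}
    (hc : completionTime J (equiShare p c) = c j) {ρ : ℝ≥0 → ℝ≥0} (hρ : ∀ u, ρ u ≤ p) {M : ℝ≥0}
    (hJ : completionTime J ρ ≤ M) (S : ℝ≥0) :
    cumul (fun u => if ((u + M : ℝ≥0) : ℝ≥0∞) < c j then equiShare p c u else 0) 0 S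
      ≤ cumul ρ 0 M := by
  -- Beyond `d` the integrand vanishes on `[0, S)`; before `d` it is the full share.
  obtain ⟨d, hd⟩ : ∃ d : ℝ≥0, (d : ℝ≥0∞) = min (S : ℝ≥0∞) (c j - M) :=
    ⟨_, ENNReal.coe_toNNReal (ne_top_of_le_ne_top ENNReal.coe_ne_top (min_le_left _ _))⟩
  have hdS : d ≤ S := ENNReal.coe_le_coe.1 (hd ▸ min_le_left _ _)
  have hlt : ∀ u : ℝ≥0, u < d → ((u + M : ℝ≥0) : ℝ≥0∞) < c j := fun u hu => by
    have h1 : (u : ℝ≥0∞) < c j - M :=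
      (ENNReal.coe_lt_coe.2 hu).trans_le (hd ▸ min_le_right _ _)
    rw [ENNReal.coe_add]
    exact lt_tsub_iff_right.1 h1
  rw [← cumul_add _ zero_le hdS]
  have h2 : cumul (fun u => if ((u + M : ℝ≥0) : ℝ≥0∞) < c j then equiShare p c u else 0) d S
      = 0 := by
    rw [cumul_congr (h := fun _ => 0), cumul_const]
    · simp
    · intro u hu hS
      refine if_neg fun h => ?_
      rw [ENNReal.coe_add] at h
      have := lt_min (ENNReal.coe_lt_coe.2 hS) (lt_tsub_iff_right.2 h)
      rw [← hd] at this
      exact absurd hu (not_le.2 (ENNReal.coe_lt_coe.1 this))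
  rw [h2, add_zero]
  refine (cumul_mono (h := equiShare p c) fun u _ _ => ?_).trans ?_
  · split_ifs
    exacts [le_rfl, zero_le]
  by_contra! hgt
  obtain ⟨z, -, hzd, hz⟩ := exists_cumul_eq (equiShare_le p c) zero_le hgt.le
  have hzd' : z < d := lt_of_le_of_ne hzd fun h => hgt.ne (by rw [← hz, h])
  have hpos : ∀ u, 0 < equiShare p c u := fun u =>
    div_pos hp (by exact_mod_cast lt_max_of_lt_right Nat.one_pos)
  have h3 := finishTimeFrom_le_of_cumul_le (s := 0) (x := 0) (y := z) (equiShare_monotone p c)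
    hpos (equiShare_le p c) hρ zero_le hJ hz.ge
  rw [add_zero] at h3
  exact absurd ((hlt z hzd').trans_le (hc.symm.le.trans h3)) (lt_irrefl _)

namespace NonClairvoyantAlgorithm.IsEqui

variable {n : ℕ} {p : ℝ≥0} {A : NonClairvoyantAlgorithm n p}

/-- The function `G` below is the total share of the jobs that live for more than another `M`,
namely `p` times the ratio of the numbers alive at `u + M` and `u`. Its integral over `[0, K * M)`
is bounded by `hup` and `hlow`, which contradict each other. -/
lemma makespan_le_of_schedule (hp : 0 < p) (hA : A.IsEqui) {K : ℕ} (hK : n < K ^ K)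
    {J : Instance n} {ρ : Fin n → ℝ≥0 → ℝ≥0} (hρ : IsSchedule p ρ) {M : ℝ≥0} (hM : 0 < M)
    (hJ : makespan J ρ ≤ M) : makespan J (A.schedule J) ≤ ((K + 1 : ℝ≥0) : ℝ≥0∞) * M := by
  by_contra! hgt
  obtain ⟨j₀, hj₀⟩ := lt_iSup_iff.1 hgt
  have hn : 0 < n := j₀.pos
  have hK0 : 0 < K := by
    rcases Nat.eq_zero_or_pos K with rfl | h
    · simp at hK
      omega
    · exact h
  set c := fun i => completionTime (J i) (A.schedule J i) with hc
  have hcr : ∀ j, completionTime (J j) (equiShare p c) = c j := fun j =>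
    completionTime_congr ((A.isSchedule J).le j) (equiShare_le p c)
      (fun u hu => by rw [hA.schedule_eq]; exact if_pos hu) le_rfl
  set g : Fin n → ℝ≥0 → ℝ≥0 := fun j u =>
    if ((u + M : ℝ≥0) : ℝ≥0∞) < c j then equiShare p c u else 0 with hg
  set G : ℝ≥0 → ℝ≥0 := fun u => ∑ j, g j u with hG
  have hgm : ∀ j, Measurable (g j) := fun j =>
    Measurable.ite (measurableSet_lt (by fun_prop) measurable_const)
      (equiShare_monotone p c).measurable measurable_const
  have hGm : Measurable G := Finset.measurable_fun_sum _ fun j _ => hgm j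
  have hup : cumul G 0 (K * M) ≤ p * M := by
    rw [cumul_sum _ hgm]
    calc ∑ j, cumul (g j) 0 (K * M) ≤ ∑ j, cumul (ρ j) 0 M :=
          Finset.sum_le_sum fun j _ => cumul_equiShare_le hp (hcr j) (hρ.le j)
            ((le_iSup (fun j => completionTime (J j) (ρ j)) j).trans hJ) _
      _ ≤ _ := (sum_cumul_le _ _ _ _).trans (by
          simpa using cumul_le_of_le hρ.2 0 M)
  have hGval : ∀ u, G u = numAlive c (u + M) * equiShare p c u := by
    intro u
    simp only [hG, hg]
    rw [← Finset.sum_filter, Finset.sum_const, nsmul_eq_mul]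
    rfl
  set q : ℝ≥0 := (K : ℝ≥0) * (1 / n : ℝ≥0) ^ (1 / K : ℝ) with hq
  have hq1 : 1 < q := by
    have hK' : (K : ℝ) ≠ 0 := by exact_mod_cast hK0.ne'
    have hn' : (n : ℝ≥0) ≠ 0 := by exact_mod_cast hn.ne'
    -- Taking `K`-th powers turns `1 < q` into `n < K ^ K`.
    refine (one_lt_pow_iff_of_nonneg zero_le hK0.ne').1 ?_
    rw [hq, mul_pow, ← NNReal.rpow_natCast (_ ^ (1 / K : ℝ)), ← NNReal.rpow_mul,
      one_div_mul_cancel hK', NNReal.rpow_one, mul_one_div, one_lt_div (pos_iff_ne_zero.2 hn')]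
    exact_mod_cast hK
  have hlow : ((p * q : ℝ≥0) : ℝ≥0∞) * M ≤ cumul G 0 (K * M) := by
    rw [← sum_cumul_consecutive, ← cumul_sum (g := fun (i : ℕ) u => G (u + i * M)) _
      fun i => hGm.comp (by fun_prop)]
    have hconst := cumul_const (p * q) 0 M
    rw [tsub_zero] at hconst
    rw [← hconst]
    refine cumul_mono fun u _ hu => ?_
    have hpos : ∀ i ≤ K, 1 ≤ numAlive c (u + i * M) := fun i hi => by
      refine one_le_numAlive (j := j₀) (lt_of_le_of_lt ?_ hj₀)
      rw [← ENNReal.coe_mul, ENNReal.coe_le_coe]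
      calc u + i * M ≤ M + K * M := by gcongr
        _ = _ := by ring
    have := le_sum_ratio hK0 (fun i => numAlive c (u + i * M)) (numAlive_le c _) hpos
    calc p * q ≤ p * ∑ i ∈ Finset.range K,
          (numAlive c (u + (i + 1 : ℕ) * M) / numAlive c (u + i * M) : ℝ≥0) := by gcongr
      _ = ∑ i ∈ Finset.range K, G (u + i * M) := by
          rw [Finset.mul_sum]
          refine Finset.sum_congr rfl fun i hi => ?_
          rw [hGval, equiShare, max_eq_left (hpos i (Finset.mem_range.1 hi).le)]
          have : u + i * M + M = u + (i + 1 : ℕ) * M := by push_cast; ring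
          rw [this]
          ring
  have := hlow.trans hup
  rw [← ENNReal.coe_mul, ← ENNReal.coe_mul, ENNReal.coe_le_coe] at this
  exact absurd this (not_le.2 (by
    calc p * M = p * 1 * M := by ring
      _ < p * q * M := by gcongr))

/-- If `n < K ^ K`, then Equi is `(K + 1)`-competitive on instances of `n` jobs. -/
theorem makespan_le (hp : 0 < p) (hA : A.IsEqui) {K : ℕ} (hK : n < K ^ K) (J : Instance n) :
    makespan J (A.schedule J) ≤ ((K + 1 : ℝ≥0) : ℝ≥0∞) * opt p J := by
  have hK1 : ((K + 1 : ℝ≥0) : ℝ≥0∞) ≠ 0 := by positivity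
  rw [mul_comm, ← ENNReal.div_le_iff hK1 ENNReal.coe_ne_top]
  refine le_of_forall_gt fun x hx => ?_
  -- The infimum need not be attained, and an `M` strictly above it is positive even if the optimum
  -- is 0.
  obtain ⟨M, hM, hMx⟩ := ENNReal.lt_iff_exists_nnreal_btwn.1 hx
  refine lt_of_le_of_lt ?_ hMx
  rw [ENNReal.div_le_iff hK1 ENNReal.coe_ne_top, mul_comm]
  obtain ⟨ρ, hM'⟩ := iInf_lt_iff.1 hM
  obtain ⟨hρ, hlt⟩ := iInf_lt_iff.1 hM'
  exact hA.makespan_le_of_schedule hp hK hρ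
    (ENNReal.coe_pos.1 (lt_of_le_of_lt zero_le hM)) hlt.le

end NonClairvoyantAlgorithm.IsEqui

/-! ### Asymptotics of the inverse of `k ^ k`. -/

lemma exists_lt_pow_self (n : ℕ) : ∃ k : ℕ, n < k ^ k :=
  ⟨n + 2, (by omega : n < n + 2).trans_le (Nat.le_self_pow (by omega) _)⟩

lemma tendsto_log_natCast : Tendsto (fun n : ℕ => Real.log n) atTop atTop :=
  Real.tendsto_log_atTop.comp tendsto_natCast_atTop_atTop

lemma tendsto_log_log_natCast : Tendsto (fun n : ℕ => Real.log (Real.log n)) atTop atTop :=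
  Real.tendsto_log_atTop.comp tendsto_log_natCast

lemma eventually_log_le_mul {η : ℝ} (hη : 0 < η) : ∀ᶠ x : ℝ in atTop, Real.log x ≤ η * x := by
  filter_upwards [Real.isLittleO_log_id_atTop.bound hη, eventually_ge_atTop 0] with x hx h0
  simpa [abs_of_nonneg h0] using (le_abs_self _).trans hx

/-- The least `k` with `n < k ^ k`. -/
noncomputable def invPowSelf (n : ℕ) : ℕ := Nat.find (exists_lt_pow_self n)

lemma lt_invPowSelf (n : ℕ) : n < invPowSelf n ^ invPowSelf n :=
  Nat.find_spec (exists_lt_pow_self n)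

/-- With `X = ln n`, `L = ln X` and `y = (1 + δ / 2) * X / L`, eventually `ln y ≥ L - ln L ≥ (1 - η)
* L`. The value of `η` makes `(1 + δ / 2) * (1 - η) = 1 + δ / 4`, so `y * ln y > X`. The other `δ /
2` absorbs the rounding and the `+ 1`. -/
lemma eventually_invPowSelf_le {δ : ℝ} (hδ : 0 < δ) : ∀ᶠ n : ℕ in atTop,
    (invPowSelf n + 1 : ℝ) ≤ (1 + δ) * (Real.log n / Real.log (Real.log n)) := by
  have hη : 0 < δ / 4 / (1 + δ / 2) := by positivity
  filter_upwards [tendsto_log_log_natCast.eventually (eventually_log_le_mul hη),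
    tendsto_log_natCast.eventually (eventually_log_le_mul (η := min 1 (δ / 4)) (by positivity)),
    tendsto_log_log_natCast.eventually_gt_atTop 0,
    tendsto_log_natCast.eventually_gt_atTop 1, eventually_gt_atTop 0] with n h1 h2 hL hX hn
  set X := Real.log n with hXdef
  set L := Real.log X with hLdef
  have hX0 : 0 < X := by linarith
  set y := (1 + δ / 2) * (X / L) with hy
  have hXL : 1 ≤ X / L := by
    rw [one_le_div hL]
    exact h2.trans (by nlinarith [min_le_left 1 (δ / 4)])
  have hXLδ : 2 ≤ δ / 2 * (X / L) := by
    have : L ≤ δ / 4 * X := h2.trans (by nlinarith [min_le_right 1 (δ / 4)])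
    rw [← mul_div_assoc, le_div_iff₀ hL]
    linarith
  have hy1 : 1 ≤ y := by nlinarith
  have hlogy : L - Real.log L ≤ Real.log y := by
    rw [hLdef, ← Real.log_div hX0.ne' hL.ne']
    exact Real.log_le_log (by positivity) (by nlinarith)
  set m := ⌈y⌉₊ with hm
  have hym : y ≤ m := Nat.le_ceil y
  have hm0 : (0 : ℝ) < m := by linarith
  have hkm : invPowSelf n ≤ m := by
    refine Nat.find_min' _ ?_
    have hlog : Real.log n < Real.log ((m ^ m : ℕ) : ℝ) := by
      push_cast
      rw [Real.log_pow]
      have h3 : (1 - δ / 4 / (1 + δ / 2)) * L ≤ Real.log y := by linarith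
      have h4 : X < y * ((1 - δ / 4 / (1 + δ / 2)) * L) := by
        have : y * ((1 - δ / 4 / (1 + δ / 2)) * L) = X * (1 + δ / 4) := by
          rw [hy]
          field_simp
          ring
        rw [this]
        nlinarith
      have h5 : y * Real.log y ≤ m * Real.log m := by
        have := Real.log_nonneg hy1
        gcongr
      have h6 : y * ((1 - δ / 4 / (1 + δ / 2)) * L) ≤ y * Real.log y := by gcongr
      linarith
    exact_mod_cast (Real.log_lt_log_iff (by exact_mod_cast hn) (by positivity)).1 hlog
  have hmy : (m : ℝ) < y + 1 := Nat.ceil_lt_add_one (by linarith)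
  have : (invPowSelf n : ℝ) ≤ m := by exact_mod_cast hkm
  have : y + 2 ≤ (1 + δ) * (X / L) := by rw [hy]; linarith
  linarith

theorem exists_isCompetitive_isEqui : ∃ ε : ℕ → ℝ, Tendsto ε atTop (𝓝 0) ∧
    ∀ n : ℕ, 3 ≤ n → ∀ p : ℝ≥0, 0 < p → ∀ A : NonClairvoyantAlgorithm n p, A.IsEqui →
      A.IsCompetitive p ((1 + ε n) * (Real.log n / Real.log (Real.log n))) := by
  -- Only an upper estimate of `invPowSelf` is known; the maximum with 0 supplies the lower half of
  -- the convergence.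
  refine ⟨fun n => max 0 ((invPowSelf n + 1) / (Real.log n / Real.log (Real.log n)) - 1), ?_, ?_⟩
  · refine tendsto_order.2 ⟨fun a ha => .of_forall fun n => lt_max_of_lt_left ha, fun a ha => ?_⟩
    filter_upwards [eventually_invPowSelf_le (half_pos ha),
      tendsto_log_log_natCast.eventually_gt_atTop 0,
      tendsto_log_natCast.eventually_gt_atTop 0] with n hn hL hX
    have : ((invPowSelf n + 1) / (Real.log n / Real.log (Real.log n)) : ℝ) ≤ 1 + a / 2 := by
      rwa [div_le_iff₀ (by positivity)]
    exact max_lt ha (by linarith)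
  · intro n hn p hp A hA J
    have h3 : (3 : ℝ) ≤ n := by exact_mod_cast hn
    have hX : 1 < Real.log n := by
      rw [Real.lt_log_iff_exp_lt (by linarith)]
      linarith [Real.exp_one_lt_d9]
    have hL : 0 < Real.log (Real.log n) := Real.log_pos hX
    refine (hA.makespan_le hp (lt_invPowSelf n) J).trans ?_
    gcongr
    rw [← ENNReal.ofReal_coe_nnreal]
    refine ENNReal.ofReal_le_ofReal ?_
    push_cast
    rw [← div_le_iff₀ (by positivity)]
    linarith [le_max_right 0
      (((invPowSelf n : ℝ) + 1) / (Real.log n / Real.log (Real.log n)) - 1)]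

/-! ### Hard instances: levels followed by a sequential phase. -/

/-- A phase of unit work that does not profit from additional processors. -/
noncomputable def seqPhase : Phase where
  work := 1
  speedUp := fun _ => 1
  monotone_speedUp := monotone_const
  sublinear_speedUp := fun _ _ h h' => one_div_le_one_div_of_le h h'.le

/-- A phase of unit work that proceeds at unit rate on up to `θ` processors, and profits linearly
from additional ones. -/
noncomputable def parPhase (θ : ℝ≥0) : Phase where
  work := 1
  speedUp := fun ρ => max 1 (ρ / θ)
  monotone_speedUp := fun _ _ h => max_le_max le_rfl (by gcongr)
  sublinear_speedUp := fun ρ ρ' h h' => by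
    rw [div_le_div_iff₀ (h.trans h') h, max_mul, max_mul]
    refine max_le_max (by simpa using h'.le) (le_of_eq ?_)
    ring

lemma seqPhase_finishTime (ρ : ℝ≥0 → ℝ≥0) (t : ℝ≥0) : seqPhase.finishTime ρ t = t + 1 := by
  have hw : ∀ b : ℝ≥0, cumul (seqPhase.rate ρ) t b = ((b - t : ℝ≥0) : ℝ≥0∞) := fun b =>
    (cumul_const 1 t b).trans (by simp)
  refine le_antisymm ?_ (le_iInf₂ fun b hb => ?_)
  · have := Phase.finishTime_le (φ := seqPhase) (ρ := ρ) (le_add_of_nonneg_right zero_le : t ≤ t + 1)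
      (by rw [hw, add_tsub_cancel_left]; exact le_rfl)
    simpa using this
  · have h1 : (1 : ℝ≥0∞) ≤ ((b - t : ℝ≥0) : ℝ≥0∞) := hb.2.trans_eq (hw b)
    have h2 : t ≤ b := ENNReal.coe_le_coe.1 hb.1
    have h3 : (1 : ℝ≥0) ≤ b - t := by exact_mod_cast h1
    have h4 : t + 1 ≤ b := by
      rw [add_comm]
      exact (le_tsub_iff_right h2).1 h3
    exact_mod_cast h4

lemma parPhase_finishTime_le (θ : ℝ≥0) (ρ : ℝ≥0 → ℝ≥0) (t : ℝ≥0) :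
    (parPhase θ).finishTime ρ t ≤ ((t + 1 : ℝ≥0) : ℝ≥0∞) := by
  refine Phase.finishTime_le (le_add_of_nonneg_right zero_le) ?_
  refine le_trans ?_ (cumul_mono (g := fun _ => 1) fun u _ _ => le_max_left _ _)
  rw [cumul_const, add_tsub_cancel_left, ENNReal.coe_one, one_mul]
  exact le_rfl

/-- The time at which the first `i` phases of unit work with thresholds `θ` are finished. -/
noncomputable def levelTime (θ : ℕ → ℝ≥0) (ρ : ℝ≥0 → ℝ≥0) : ℕ → ℝ≥0
  | 0 => 0
  | i + 1 => ((parPhase (θ i)).finishTime ρ (levelTime θ ρ i)).toNNReal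

/-- The job with `d` phases with thresholds `θ`, followed by a sequential one. -/
noncomputable def hardJob (θ : ℕ → ℝ≥0) (d : ℕ) : Job :=
  (List.range d).map (fun i => parPhase (θ i)) ++ [seqPhase]

section levels

variable (θ : ℕ → ℝ≥0) (ρ : ℝ≥0 → ℝ≥0)

lemma coe_levelTime_succ (i : ℕ) :
    (levelTime θ ρ (i + 1) : ℝ≥0∞) = (parPhase (θ i)).finishTime ρ (levelTime θ ρ i) :=
  ENNReal.coe_toNNReal (ne_top_of_le_ne_top ENNReal.coe_ne_top (parPhase_finishTime_le _ _ _))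

lemma levelTime_succ_le (i : ℕ) : levelTime θ ρ (i + 1) ≤ levelTime θ ρ i + 1 := by
  rw [← ENNReal.coe_le_coe, coe_levelTime_succ]
  exact parPhase_finishTime_le _ _ _

lemma levelTime_monotone : Monotone (levelTime θ ρ) := by
  refine monotone_nat_of_le_succ fun i => ?_
  rw [← ENNReal.coe_le_coe, coe_levelTime_succ]
  exact Phase.le_finishTime _ _ _

lemma levelTime_le (i : ℕ) : levelTime θ ρ i ≤ i := by
  induction i with
  | zero => simp [levelTime]
  | succ i ih => exact (levelTime_succ_le θ ρ i).trans (by push_cast; gcongr)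

lemma finishTimeFrom_levels (d : ℕ) :
    finishTimeFrom ρ ((List.range d).map fun i => parPhase (θ i)) 0 = levelTime θ ρ d := by
  induction d with
  | zero => simp [finishTimeFrom, levelTime]
  | succ d ih =>
    rw [List.range_succ, List.map_append, finishTimeFrom_append, ih, coe_levelTime_succ]
    rfl

lemma completionTime_hardJob (d : ℕ) :
    completionTime (hardJob θ d) ρ = ((levelTime θ ρ d + 1 : ℝ≥0) : ℝ≥0∞) := by
  rw [completionTime, hardJob, finishTimeFrom_append, finishTimeFrom_levels]
  simpa [finishTimeFrom] using seqPhase_finishTime ρ (levelTime θ ρ d)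

variable {θ ρ}

lemma levelTime_congr {ρ' : ℝ≥0 → ℝ≥0} {P : ℝ≥0} (hρ : ∀ u, ρ u ≤ P) (hρ' : ∀ u, ρ' u ≤ P)
    {d : ℕ} (h : ∀ u < levelTime θ ρ d, ρ u = ρ' u) : levelTime θ ρ' d = levelTime θ ρ d := by
  rw [← ENNReal.coe_inj, ← finishTimeFrom_levels, ← finishTimeFrom_levels]
  exact finishTimeFrom_congr hρ hρ' (fun u hu => h u (ENNReal.coe_lt_coe.1 hu))
    (finishTimeFrom_levels θ ρ d).le

/-- Since `max 1 (ρ / θ) ≤ 1 + ρ / θ`, the time saved in a level is at most the processor time spent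
on it divided by `θ`. The window is enlarged to unit length in order to match that of a final phase.
-/
lemma one_le_levelTime_sub {P : ℝ≥0} (hρ : ∀ u, ρ u ≤ P) (i : ℕ) :
    (1 : ℝ≥0∞) ≤ ((levelTime θ ρ (i + 1) - levelTime θ ρ i : ℝ≥0) : ℝ≥0∞) +
      ((θ i)⁻¹ : ℝ≥0) * cumul ρ (levelTime θ ρ i) (levelTime θ ρ i + 1) := by
  have h := ((Phase.finishTime_le_iff hρ).1 (coe_levelTime_succ θ ρ i).ge).2
  calc (1 : ℝ≥0∞) ≤ cumul ((parPhase (θ i)).rate ρ) (levelTime θ ρ i) (levelTime θ ρ (i + 1)) := by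
        simpa [parPhase] using h
    _ ≤ cumul (fun u => 1 + (θ i)⁻¹ * ρ u) (levelTime θ ρ i) (levelTime θ ρ (i + 1)) := by
        refine cumul_mono fun u _ _ => max_le (le_add_of_nonneg_right zero_le) ?_
        rw [div_eq_inv_mul]
        exact le_add_of_nonneg_left zero_le
    _ ≤ _ := by
        rw [cumul_const_add, cumul_const_mul, ENNReal.coe_one, one_mul]
        gcongr
        exact cumul_subset _ le_rfl (levelTime_succ_le θ ρ i)

lemma le_levelTime_add {P : ℝ≥0} (hρ : ∀ u, ρ u ≤ P) (K : ℕ) :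
    (K : ℝ≥0∞) ≤ levelTime θ ρ K + ∑ i ∈ Finset.range K,
      ((θ i)⁻¹ : ℝ≥0) * cumul ρ (levelTime θ ρ i) (levelTime θ ρ i + 1) := by
  induction K with
  | zero => simp
  | succ K ih =>
    have h : levelTime θ ρ K + (levelTime θ ρ (K + 1) - levelTime θ ρ K) = levelTime θ ρ (K + 1) :=
      add_tsub_cancel_of_le (levelTime_monotone θ ρ K.le_succ)
    rw [Finset.sum_range_succ, ← h, ENNReal.coe_add, Nat.cast_add, Nat.cast_one]
    refine (add_le_add ih (one_le_levelTime_sub (θ := θ) hρ K)).trans_eq ?_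
    ring

lemma levelTime_const_mul_le (hθ : ∀ i, 0 < θ i) (x : ℝ≥0) (d : ℕ) :
    levelTime θ (fun _ => x) d * x ≤ ∑ i ∈ Finset.range d, θ i := by
  rcases eq_or_ne x 0 with rfl | hx
  · simp
  rw [← le_div_iff₀ (pos_iff_ne_zero.2 hx)]
  induction d with
  | zero => simp [levelTime]
  | succ d ih =>
    rw [Finset.sum_range_succ, add_div]
    refine le_trans ?_ (add_le_add_left ih _)
    rw [← ENNReal.coe_le_coe, coe_levelTime_succ]
    refine Phase.finishTime_le (le_add_of_nonneg_right zero_le) ?_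
    change _ ≤ cumul (fun _ => max 1 (x / θ d)) _ _
    rw [cumul_const, add_tsub_cancel_left, ← ENNReal.coe_mul, ENNReal.coe_le_coe]
    have h1 := (hθ d).ne'
    calc (1 : ℝ≥0) = x / θ d * (θ d / x) := by field_simp
      _ ≤ _ := by gcongr; exact le_max_right _ _

end levels

/-- The instance whose `j`-th job has `D j` phases with thresholds `θ`, followed by a sequential
one. -/
noncomputable def hardInstance {n K : ℕ} (θ : ℕ → ℝ≥0) (D : Fin n → Fin (K + 1)) : Instance n :=
  fun j => hardJob θ (D j)

/-- Constant allotments proportional to the total thresholds `W j` finish all levels by time `S /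
p`; the sequential phases then take one more unit. -/
lemma opt_hardInstance_le {n K : ℕ} {p : ℝ≥0} (hp : 0 < p) {θ : ℕ → ℝ≥0} (hθ : ∀ i, 0 < θ i)
    (D : Fin n → Fin (K + 1)) :
    opt p (hardInstance θ D)
      ≤ ((1 + (∑ j, ∑ i ∈ Finset.range (D j), θ i) / p : ℝ≥0) : ℝ≥0∞) := by
  set W : Fin n → ℝ≥0 := fun j => ∑ i ∈ Finset.range (D j), θ i with hW
  set S := ∑ j, W j with hS
  have hsched : IsSchedule p fun j (_ : ℝ≥0) => p * W j / S := by
    refine ⟨fun j T => ⟨∅, fun _ _ _ _ _ => rfl⟩, fun t => ?_⟩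
    rw [← Finset.sum_div, ← Finset.mul_sum, ← hS, mul_div_assoc]
    exact mul_le_of_le_one_right zero_le (div_self_le_one S)
  refine (iInf₂_le _ hsched).trans (iSup_le fun j => ?_)
  rw [hardInstance, completionTime_hardJob, ENNReal.coe_le_coe, add_comm]
  gcongr
  rcases Nat.eq_zero_or_pos (D j : ℕ) with h0 | h0
  · simp [h0, levelTime]
  have hWj : 0 < W j := Finset.sum_pos (fun i _ => hθ i) (by simpa using h0.ne')
  have hS0 : 0 < S := hWj.trans_le (Finset.single_le_sum (fun _ _ => zero_le) (Finset.mem_univ j))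
  have h := levelTime_const_mul_le hθ (p * W j / S) (D j)
  rw [← le_div_iff₀ (by positivity)] at h
  refine h.trans_eq ?_
  change W j / (p * W j / S) = S / p
  field_simp

/-- The processor time that a job is allotted during its final, sequential phase. -/
noncomputable def finalShare {n K : ℕ} {P : ℝ≥0} (A : NonClairvoyantAlgorithm n P) (θ : ℕ → ℝ≥0)
    (D : Fin n → Fin (K + 1)) (j : Fin n) : ℝ≥0∞ :=
  cumul (A.schedule (hardInstance θ D) j)
    (levelTime θ (A.schedule (hardInstance θ D) j) (D j))
    (levelTime θ (A.schedule (hardInstance θ D) j) (D j) + 1)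

section algorithm

variable {n K : ℕ} {P : ℝ≥0} (A : NonClairvoyantAlgorithm n P) (θ : ℕ → ℝ≥0)
  (D : Fin n → Fin (K + 1))

lemma sum_finalShare_le : ∑ j, finalShare A θ D j ≤ P * (K + 1) := by
  calc ∑ j, finalShare A θ D j ≤ ∑ j, cumul (A.schedule (hardInstance θ D) j) 0 (K + 1) := by
        refine Finset.sum_le_sum fun j _ => cumul_subset _ zero_le ?_
        gcongr
        exact (levelTime_le _ _ _).trans (by exact_mod_cast Nat.lt_succ_iff.1 (D j).2)
    _ ≤ _ := (sum_cumul_le _ _ _ _).trans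
        ((cumul_le_of_le (A.isSchedule (hardInstance θ D)).2 _ _).trans_eq (by simp))

/-- With `i` levels job `j` is completed exactly at `a + 1`, with `K` levels not earlier. So no
completion tells the two instances apart before `a + 1`. -/
lemma finalShare_update (j : Fin n) (i : Fin (K + 1)) :
    finalShare A θ (Function.update D j i) j =
      cumul (A.schedule (hardInstance θ (Function.update D j (Fin.last K))) j)
        (levelTime θ (A.schedule (hardInstance θ (Function.update D j (Fin.last K))) j) i)
        (levelTime θ (A.schedule (hardInstance θ (Function.update D j (Fin.last K))) j) i + 1) := by
  set J := hardInstance θ (Function.update D j (Fin.last K))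
  set J' := hardInstance θ (Function.update D j i)
  set a := levelTime θ (A.schedule J j) i
  have hT : ∀ l, min (completionTime (J' l) (A.schedule J l)) ((a + 1 : ℝ≥0) : ℝ≥0∞) =
      min (completionTime (J l) (A.schedule J l)) ((a + 1 : ℝ≥0) : ℝ≥0∞) := by
    intro l
    by_cases hl : l = j
    · subst hl
      have h1 : J' l = hardJob θ i := by simp [J', hardInstance]
      have h2 : J l = hardJob θ K := by simp [J, hardInstance]
      rw [h1, h2, completionTime_hardJob, completionTime_hardJob, min_self, min_eq_right]
      rw [ENNReal.coe_le_coe]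
      gcongr
      exact levelTime_monotone θ _ (Nat.lt_succ_iff.1 i.2)
    · have : J' l = J l := by simp [J, J', hardInstance, Function.update_of_ne hl]
      rw [this]
  have hag : ∀ u < a + 1, A.schedule J j u = A.schedule J' j u := fun u hu =>
    A.schedule_eqOn hT (ENNReal.coe_lt_coe.2 hu) j
  have ha : levelTime θ (A.schedule J' j) i = a :=
    levelTime_congr ((A.isSchedule J).le j) ((A.isSchedule J').le j) fun u hu =>
      hag u (hu.trans_le (le_add_of_nonneg_right zero_le))
  rw [finalShare, Function.update_self, ha]
  exact cumul_congr fun u _ hu => (hag u hu).symm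

/-- Job `j` needs `K + 1` minus the time saved in its levels. The saving in level `i` is bounded by
what the job receives in its final phase when it has only `i` levels. -/
lemma le_makespan_add (j : Fin n) :
    (K + 1 : ℝ≥0∞) ≤ makespan (hardInstance θ (Function.update D j (Fin.last K)))
        (A.schedule (hardInstance θ (Function.update D j (Fin.last K)))) +
      ∑ i : Fin K, ((θ i)⁻¹ : ℝ≥0) * finalShare A θ (Function.update D j i.castSucc) j := by
  set J := hardInstance θ (Function.update D j (Fin.last K)) with hJ
  have h1 : ((levelTime θ (A.schedule J j) K + 1 : ℝ≥0) : ℝ≥0∞) ≤ makespan J (A.schedule J) := by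
    refine le_trans (le_of_eq ?_) (le_iSup _ j)
    have h2 : J j = hardJob θ K := by simp [J, hardInstance]
    rw [h2, completionTime_hardJob]
  have h3 := le_levelTime_add (θ := θ) ((A.isSchedule J).le j) K
  simp only [finalShare_update, ← hJ, Fin.val_castSucc]
  rw [Finset.sum_range] at h3
  calc (K + 1 : ℝ≥0∞) ≤ _ + 1 := add_le_add_left h3 1
    _ = _ := add_right_comm _ _ _
    _ ≤ _ := add_le_add_left (by simpa using h1) _

end algorithm

/-! ### Averaging over independent random depths. -/

section productWeights

variable {κ ι : Type*} [Fintype κ] [DecidableEq κ] [Fintype ι] {q : ι → ℝ≥0}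

lemma sum_prod_eq_one (hq : ∑ x, q x = 1) : ∑ D : κ → ι, ∏ l, q (D l) = 1 := by
  rw [← Fintype.prod_sum fun (_ : κ) x => q x]
  simp [hq]

/-- Resampling one coordinate does not change expectations. -/
lemma sum_prod_mul_sum_update (hq : ∑ x, q x = 1) (j : κ) (F : (κ → ι) → ℝ≥0∞) :
    ∑ D : κ → ι, ((∏ l, q (D l) : ℝ≥0) : ℝ≥0∞) * ∑ x, q x * F (Function.update D j x) =
      ∑ D : κ → ι, ((∏ l, q (D l) : ℝ≥0) : ℝ≥0∞) * F D := by
  -- Exchanging `D j` with the fresh sample preserves the product weight.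
  have hinv : Function.Involutive fun z : (κ → ι) × ι => (Function.update z.1 j z.2, z.1 j) := by
    intro z
    simp
  have hw : ∀ (D : κ → ι) (x : ι),
      (∏ l, q (D l)) * q x = (∏ l, q (Function.update D j x l)) * q (D j) := by
    intro D x
    have h1 : (fun l => q (Function.update D j x l)) = Function.update (fun l => q (D l)) j (q x) :=
      funext fun l => Function.apply_update (fun _ => q) D j x l
    rw [h1, Finset.prod_update_of_mem (Finset.mem_univ j),
      ← Finset.mul_prod_erase Finset.univ (fun l => q (D l)) (Finset.mem_univ j),
      Finset.sdiff_singleton_eq_erase]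
    ring
  calc _ = ∑ z : (κ → ι) × ι, (((∏ l, q (z.1 l)) * q z.2 : ℝ≥0) : ℝ≥0∞) *
          F (Function.update z.1 j z.2) := by
        simp only [Fintype.sum_prod_type, Finset.mul_sum, ENNReal.coe_mul, mul_assoc]
    _ = ∑ z : (κ → ι) × ι, (((∏ l, q (z.1 l)) * q z.2 : ℝ≥0) : ℝ≥0∞) * F z.1 := by
        refine Fintype.sum_equiv hinv.toPerm _ _ fun z => ?_
        rw [hw]
        rfl
    _ = _ := by
        simp only [Fintype.sum_prod_type, ENNReal.coe_mul]
        refine Finset.sum_congr rfl fun D _ => ?_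
        rw [← Finset.sum_mul, ← Finset.mul_sum, ← ENNReal.ofNNReal_finsetSum, hq]
        simp

lemma sum_prod_mul_apply (hq : ∑ x, q x = 1) (j : κ) (f : ι → ℝ≥0) :
    ∑ D : κ → ι, (∏ l, q (D l)) * f (D j) = ∑ x, q x * f x := by
  have h := sum_prod_mul_sum_update hq j fun D => (f (D j) : ℝ≥0∞)
  simp only [Function.update_self] at h
  rw [← Finset.sum_mul] at h
  have h1 := sum_prod_eq_one (κ := κ) hq
  rw [← ENNReal.ofNNReal_finsetSum, h1] at h
  rw [← ENNReal.coe_inj]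
  push_cast at h ⊢
  rw [← h, one_mul]

end productWeights

section averaging

variable {n K : ℕ} {P p k : ℝ≥0} {θ : ℕ → ℝ≥0} {q : Fin (K + 1) → ℝ≥0}

/-- The relation between `θ` and `q` turns the savings of job `j` into at most `k⁻¹` times its
expected final share with resampled depth. Resampling is then undone, and `sum_finalShare_le` bounds
the sum over all jobs. -/
lemma mul_le_average_makespan (A : NonClairvoyantAlgorithm n P) (hq : ∑ x, q x = 1)
    (hθ : ∀ i : Fin K, (θ i)⁻¹ = k⁻¹ * q i.castSucc) :
    (n : ℝ≥0∞) * (K + 1) ≤ ∑ j, ∑ D : Fin n → Fin (K + 1), ((∏ l, q (D l) : ℝ≥0) : ℝ≥0∞) *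
        makespan (hardInstance θ (Function.update D j (Fin.last K)))
          (A.schedule (hardInstance θ (Function.update D j (Fin.last K)))) +
      (k⁻¹ : ℝ≥0) * (P * (K + 1)) := by
  have hw : ∑ D : Fin n → Fin (K + 1), ((∏ l, q (D l) : ℝ≥0) : ℝ≥0∞) = 1 := by
    rw [← ENNReal.ofNNReal_finsetSum, sum_prod_eq_one hq, ENNReal.coe_one]
  have hshare : ∑ j, ∑ D : Fin n → Fin (K + 1), ((∏ l, q (D l) : ℝ≥0) : ℝ≥0∞) *
      ∑ i : Fin K, ((θ i)⁻¹ : ℝ≥0) * finalShare A θ (Function.update D j i.castSucc) j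
        ≤ (k⁻¹ : ℝ≥0) * (P * (K + 1)) := by
    calc _ ≤ ∑ j, ∑ D : Fin n → Fin (K + 1), ((∏ l, q (D l) : ℝ≥0) : ℝ≥0∞) *
          ((k⁻¹ : ℝ≥0) * ∑ x, q x * finalShare A θ (Function.update D j x) j) := by
          gcongr
          rw [Fin.sum_univ_castSucc, mul_add, Finset.mul_sum]
          refine le_trans (le_of_eq ?_) (le_add_of_nonneg_right zero_le)
          exact Finset.sum_congr rfl fun i _ => by rw [hθ, ENNReal.coe_mul, mul_assoc]
      _ = (k⁻¹ : ℝ≥0) * ∑ j, ∑ D : Fin n → Fin (K + 1), ((∏ l, q (D l) : ℝ≥0) : ℝ≥0∞) *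
            finalShare A θ D j := by
          rw [Finset.mul_sum]
          refine Finset.sum_congr rfl fun j _ => ?_
          rw [← sum_prod_mul_sum_update hq j fun D => finalShare A θ D j, Finset.mul_sum]
          exact Finset.sum_congr rfl fun D _ => mul_left_comm _ _ _
      _ = (k⁻¹ : ℝ≥0) * ∑ D : Fin n → Fin (K + 1), ((∏ l, q (D l) : ℝ≥0) : ℝ≥0∞) *
            ∑ j, finalShare A θ D j := by
          rw [Finset.sum_comm]
          simp only [Finset.mul_sum]
      _ ≤ (k⁻¹ : ℝ≥0) * ∑ D : Fin n → Fin (K + 1), ((∏ l, q (D l) : ℝ≥0) : ℝ≥0∞) *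
            (P * (K + 1)) := by
          gcongr with D
          exact sum_finalShare_le A θ D
      _ = _ := by rw [← Finset.sum_mul, hw, one_mul]
  calc (n : ℝ≥0∞) * (K + 1)
      = ∑ _j : Fin n, ∑ D : Fin n → Fin (K + 1), ((∏ l, q (D l) : ℝ≥0) : ℝ≥0∞) * (K + 1) := by
        rw [Finset.sum_const, Finset.card_univ, Fintype.card_fin, nsmul_eq_mul,
          ← Finset.sum_mul, hw, one_mul]
    _ ≤ ∑ j, ∑ D : Fin n → Fin (K + 1), ((∏ l, q (D l) : ℝ≥0) : ℝ≥0∞) * _ :=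
        Finset.sum_le_sum fun j _ => Finset.sum_le_sum fun D _ =>
          mul_le_mul_right (le_makespan_add A θ D j) _
    _ ≤ _ := by
        simp only [mul_add, Finset.sum_add_distrib]
        simp only [mul_add] at hshare
        gcongr

/-- Forcing job `j` to full depth adds at most the total threshold of one deepest job, the term
outside the factor `n`. -/
lemma average_opt_le (hp : 0 < p) (hθ0 : ∀ i, 0 < θ i) (hq : ∑ x, q x = 1) :
    ∑ j, ∑ D : Fin n → Fin (K + 1), ((∏ l, q (D l) : ℝ≥0) : ℝ≥0∞) *
        opt p (hardInstance θ (Function.update D j (Fin.last K)))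
      ≤ ((n * (1 + (n * ∑ x, q x * ∑ i ∈ Finset.range x, θ i +
        ∑ i ∈ Finset.range K, θ i) / p) : ℝ≥0) : ℝ≥0∞) := by
  set W : Fin (K + 1) → ℝ≥0 := fun x => ∑ i ∈ Finset.range x, θ i with hW
  have hupd : ∀ (D : Fin n → Fin (K + 1)) (j : Fin n),
      ∑ l, W (Function.update D j (Fin.last K) l) ≤ ∑ l, W (D l) + W (Fin.last K) := by
    intro D j
    have h1 : (fun l => W (Function.update D j (Fin.last K) l))
        = Function.update (fun l => W (D l)) j (W (Fin.last K)) :=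
      funext fun l => Function.apply_update (fun _ => W) D j (Fin.last K) l
    rw [h1, Finset.sum_update_of_mem (Finset.mem_univ j), add_comm]
    gcongr
    exact Finset.subset_univ _
  calc _ ≤ ∑ _j : Fin n, ∑ D : Fin n → Fin (K + 1), ((∏ l, q (D l) : ℝ≥0) : ℝ≥0∞) *
        ((1 + (∑ l, W (D l) + W (Fin.last K)) / p : ℝ≥0) : ℝ≥0∞) := by
        gcongr with j _ D
        refine (opt_hardInstance_le hp hθ0 _).trans (ENNReal.coe_le_coe.2 ?_)
        gcongr
        exact hupd D j
    _ = _ := by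
        simp only [← ENNReal.coe_mul, ← ENNReal.ofNNReal_finsetSum]
        congr 1
        rw [Finset.sum_const, Finset.card_univ, Fintype.card_fin, nsmul_eq_mul]
        congr 1
        have h1 : ∀ D : Fin n → Fin (K + 1),
            (∏ l, q (D l)) * (1 + (∑ l, W (D l) + W (Fin.last K)) / p) =
            (∏ l, q (D l)) * (1 + W (Fin.last K) / p) +
              (∑ l, (∏ l, q (D l)) * W (D l)) / p := by
          intro D
          rw [← Finset.mul_sum]
          ring
        simp only [h1]
        rw [Finset.sum_add_distrib, ← Finset.sum_mul, sum_prod_eq_one hq, ← Finset.sum_div,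
          Finset.sum_comm]
        simp only [sum_prod_mul_apply hq]
        rw [Finset.sum_const, Finset.card_univ, Fintype.card_fin, nsmul_eq_mul]
        simp only [hW, Fin.val_last]
        ring

lemma RandomizedAlgorithm.mul_le_of_isCompetitive {Ω : Type*} [MeasurableSpace Ω]
    {μ : Measure Ω} [IsProbabilityMeasure μ] {A : RandomizedAlgorithm Ω n P} {c : ℝ}
    (hA : A.IsCompetitive μ p c) (hp : 0 < p) (hθ0 : ∀ i, 0 < θ i) (hq : ∑ x, q x = 1)
    (hθ : ∀ i : Fin K, (θ i)⁻¹ = k⁻¹ * q i.castSucc) :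
    (n * (K + 1) : ℝ≥0) ≤ c.toNNReal * (n * (1 + (n * ∑ x, q x * ∑ i ∈ Finset.range x, θ i +
        ∑ i ∈ Finset.range K, θ i) / p)) + k⁻¹ * (P * (K + 1)) := by
  rw [← ENNReal.coe_le_coe]
  set J : Fin n → (Fin n → Fin (K + 1)) → Instance n := fun j D =>
    hardInstance θ (Function.update D j (Fin.last K)) with hJ
  have hmeas : ∀ j D, Measurable fun ω => ((∏ l, q (D l) : ℝ≥0) : ℝ≥0∞) *
      makespan (J j D) ((A.run ω).schedule (J j D)) := fun j D =>
    (A.measurable_makespan _).const_mul _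
  calc ((n * (K + 1) : ℝ≥0) : ℝ≥0∞) = ∫⁻ _ω, (n : ℝ≥0∞) * (K + 1) ∂μ := by simp
    _ ≤ ∫⁻ ω, (∑ j, ∑ D, ((∏ l, q (D l) : ℝ≥0) : ℝ≥0∞) *
          makespan (J j D) ((A.run ω).schedule (J j D)) + (k⁻¹ : ℝ≥0) * (P * (K + 1))) ∂μ :=
        lintegral_mono fun ω => mul_le_average_makespan (A.run ω) hq hθ
    _ = ∑ j, ∑ D, ((∏ l, q (D l) : ℝ≥0) : ℝ≥0∞) *
          ∫⁻ ω, makespan (J j D) ((A.run ω).schedule (J j D)) ∂μ +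
            (k⁻¹ : ℝ≥0) * (P * (K + 1)) := by
        rw [lintegral_add_right _ measurable_const, lintegral_const, measure_univ, mul_one,
          lintegral_finsetSum _ fun j _ => Finset.measurable_fun_sum _ fun D _ => hmeas j D]
        congr 1
        refine Finset.sum_congr rfl fun j _ => ?_
        rw [lintegral_finsetSum _ fun D _ => hmeas j D]
        exact Finset.sum_congr rfl fun D _ => lintegral_const_mul _ (A.measurable_makespan _)
    _ ≤ ∑ j, ∑ D, ((∏ l, q (D l) : ℝ≥0) : ℝ≥0∞) * (ENNReal.ofReal c * opt p (J j D)) +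
            (k⁻¹ : ℝ≥0) * (P * (K + 1)) := by
        gcongr with j _ D
        exact hA _
    _ = ENNReal.ofReal c * ∑ j, ∑ D, ((∏ l, q (D l) : ℝ≥0) : ℝ≥0∞) * opt p (J j D) +
            (k⁻¹ : ℝ≥0) * (P * (K + 1)) := by
        simp only [Finset.mul_sum, mul_left_comm]
    _ ≤ _ := add_le_add_left (mul_le_mul_right (average_opt_le hp hθ0 hq) _) _
    _ = _ := by
        rw [ENNReal.ofReal]
        push_cast
        rfl

end averaging

/-! ### Geometric weights and the choice of parameters. -/

section geometricWeights

variable {b : ℝ≥0} (k : ℝ≥0)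

lemma sum_geometric_weights (hb : 0 < b) (K : ℕ) :
    ∑ i ∈ Finset.range K, b / (b + 1) ^ (i + 1) + 1 / (b + 1) ^ K = 1 := by
  induction K with
  | zero => simp
  | succ K ih =>
    refine Eq.trans ?_ ih
    rw [Finset.sum_range_succ, add_assoc]
    congr 1
    field_simp
    ring

lemma sum_geometric_thresholds (hb : 0 < b) (K : ℕ) :
    ∑ i ∈ Finset.range K, k * (b + 1) ^ (i + 1) / b + k * (b + 1) / b ^ 2
      = k * (b + 1) ^ (K + 1) / b ^ 2 := by
  induction K with
  | zero => simp
  | succ K ih =>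
    rw [Finset.sum_range_succ, add_right_comm, ih]
    field_simp
    ring

/-- Level `i` is present with probability `1 / (b + 1) ^ (i + 1)`, so each of the `K` levels
contributes `k / b` to the expectation. -/
lemma sum_weights_mul_thresholds (hb : 0 < b) (K : ℕ) :
    ∑ d ∈ Finset.range K, b / (b + 1) ^ (d + 1) *
        ∑ i ∈ Finset.range d, k * (b + 1) ^ (i + 1) / b +
      1 / (b + 1) ^ K * ∑ i ∈ Finset.range K, k * (b + 1) ^ (i + 1) / b = k * K / b := by
  induction K with
  | zero => simp
  | succ K ih =>
    rw [Finset.sum_range_succ, Finset.sum_range_succ _ K]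
    set W := ∑ i ∈ Finset.range K, k * (b + 1) ^ (i + 1) / b
    calc _ = (∑ d ∈ Finset.range K, b / (b + 1) ^ (d + 1) *
          ∑ i ∈ Finset.range d, k * (b + 1) ^ (i + 1) / b + 1 / (b + 1) ^ K * W) + k / b := by
          rw [add_assoc, add_assoc]
          congr 1
          field_simp
          ring
      _ = _ := by
          rw [ih]
          push_cast
          field_simp

end geometricWeights

/-- A competitive randomized algorithm with speed `s` satisfies a trade-off for all parameters of
the hard random instance. -/
theorem RandomizedAlgorithm.IsCompetitive.le_add {Ω : Type*} [MeasurableSpace Ω]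
    {μ : Measure Ω} [IsProbabilityMeasure μ] {n : ℕ} {s p : ℝ≥0}
    {A : RandomizedAlgorithm Ω n (s * p)} {c : ℝ} (hA : A.IsCompetitive μ p c) (hp : 0 < p)
    {K : ℕ} {b lam : ℝ≥0} (hb : 1 ≤ b) (hlam : 0 < lam) (hn : (b + 1) ^ K ≤ n) :
    (K + 1 : ℝ≥0) ≤ c.toNNReal * (1 + lam * (K + 2) / b) + s * (K + 1) / lam := by
  have hb0 : 0 < b := one_pos.trans_le hb
  have hn0 : (0 : ℝ≥0) < n := lt_of_lt_of_le (by positivity) hn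
  -- This `k` makes the savings per job equal to `s * (K + 1) / lam` and the expected optimum at
  -- most `1 + lam * (K + 2) / b`.
  set k : ℝ≥0 := p * lam / n with hk
  have hk0 : 0 < k := by positivity
  set q : Fin (K + 1) → ℝ≥0 := Fin.snoc (fun i : Fin K => b / (b + 1) ^ ((i : ℕ) + 1))
    (1 / (b + 1) ^ K) with hq
  set θ : ℕ → ℝ≥0 := fun i => k * (b + 1) ^ (i + 1) / b with hθ
  have hsum : ∀ f : ℕ → ℝ≥0, ∑ x, q x * f x = ∑ d ∈ Finset.range K, b / (b + 1) ^ (d + 1) * f d +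
      1 / (b + 1) ^ K * f K := by
    intro f
    rw [Fin.sum_univ_castSucc, Finset.sum_range]
    simp [hq]
  have hq1 : ∑ x, q x = 1 := by
    have := hsum fun _ => 1
    simp only [mul_one] at this
    rw [this, sum_geometric_weights hb0]
  have key := RandomizedAlgorithm.mul_le_of_isCompetitive hA (θ := θ) (k := k) (q := q) hp (fun i => by positivity)
    hq1 (fun i => by
      simp only [hq, hθ, Fin.snoc_castSucc]
      field_simp)
  rw [hsum fun d => ∑ i ∈ Finset.range d, θ i, sum_weights_mul_thresholds k hb0 K] at key
  -- The single job of full depth costs no more than two levels do in expectation over all `n` jobs.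
  have hW : ∑ i ∈ Finset.range K, θ i ≤ 2 * k * n / b := by
    calc ∑ i ∈ Finset.range K, θ i ≤ k * (b + 1) ^ (K + 1) / b ^ 2 := by
          rw [← sum_geometric_thresholds k hb0 K]
          exact le_add_of_nonneg_right zero_le
      _ = k * (b + 1) ^ K * (b + 1) / b ^ 2 := by ring
      _ ≤ k * n * (2 * b) / b ^ 2 := by
          gcongr
          rw [two_mul]
          gcongr
      _ = _ := by field_simp
  have h1 : (n * (K + 1) : ℝ≥0) ≤ n * (c.toNNReal * (1 + lam * (K + 2) / b) +
      s * (K + 1) / lam) := by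
    calc (n * (K + 1) : ℝ≥0) ≤ _ := key
      _ ≤ c.toNNReal * (n * (1 + (n * (k * K / b) + 2 * k * n / b) / p)) +
          k⁻¹ * (s * p * (K + 1)) := by gcongr
      _ = _ := by
          rw [hk]
          field_simp
  exact le_of_mul_le_mul_left h1 hn0

/-- The trade-off of `RandomizedAlgorithm.IsCompetitive.le_add` forces the ratio
`ln n / (2 ln ln n)`. -/
lemma eventually_le_of_tradeoff {s : ℕ → ℝ≥0}
    (hs : (fun n => (s n : ℝ)) =o[atTop] fun n : ℕ => Real.log n / Real.log (Real.log n)) :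
    ∀ᶠ n : ℕ in atTop, ∃ (K : ℕ) (b lam : ℝ≥0), 1 ≤ b ∧ 0 < lam ∧ (b + 1) ^ K ≤ (n : ℝ≥0) ∧
      ∀ C : ℝ≥0, (K + 1 : ℝ≥0) ≤ C * (1 + lam * (K + 2) / b) + s n * (K + 1) / lam →
        Real.log n / (2 * Real.log (Real.log n)) ≤ C := by
  set η : ℝ := Real.exp (-10) / 2 with hη
  have hη0 : 0 < η := by positivity
  filter_upwards [hs.bound (half_pos hη0),
    tendsto_log_natCast.eventually (eventually_log_le_mul (half_pos hη0)),
    tendsto_log_natCast.eventually (eventually_log_le_mul (show (0 : ℝ) < 1 / 8 by norm_num)),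
    tendsto_log_log_natCast.eventually_ge_atTop 8,
    tendsto_log_natCast.eventually_ge_atTop (max 1 (1 / η)), eventually_gt_atTop 0]
    with n h1 h2 h3 hL hX hn
  set X := Real.log n with hXdef
  set L := Real.log X with hLdef
  have hX1 : 1 ≤ X := (le_max_left _ _).trans hX
  have hXη : 1 ≤ η * X := by
    have := (le_max_right _ _).trans hX
    rwa [div_le_iff₀ hη0, mul_comm] at this
  have hL0 : 0 < L := by linarith
  have hX0 : 0 < X := by linarith
  rw [Real.norm_of_nonneg (s n).coe_nonneg, Real.norm_of_nonneg (by positivity)] at h1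
  have hs1 : (s n : ℝ) + 1 ≤ η * (X / L) := by
    have : 1 ≤ η / 2 * (X / L) := by rwa [← mul_div_assoc, one_le_div hL0]
    linarith
  set y := X / (2 * L) * (1 + 4 / L) with hy
  have hy0 : 0 ≤ y := by positivity
  set K := ⌊y⌋₊ with hK
  have hKy : (K : ℝ) ≤ y := Nat.floor_le hy0
  have hyK : y < K + 1 := Nat.lt_floor_add_one y
  have hK2 : (K : ℝ) + 2 ≤ X / L := by
    have h4 : 1 + 4 / L ≤ 3 / 2 := by
      have : 4 / L ≤ 1 / 2 := by rw [div_le_iff₀ hL0]; linarith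
      linarith
    have h5 : y ≤ X / (2 * L) * (3 / 2) := by rw [hy]; gcongr
    have h6 : X / (2 * L) * (3 / 2) = 3 / 4 * (X / L) := by field_simp; ring
    have h7 : 8 ≤ X / L := by rw [le_div_iff₀ hL0]; linarith
    linarith
  -- With these choices `lam * (K + 2) / b = 1 / L` and `s n * (K + 1) / lam ≤ (K + 1) / L`, so both
  -- error terms are of relative order `1 / L`.
  set lam : ℝ≥0 := ⟨L, hL0.le⟩ * (s n + 1) with hlam
  have hlamR : (lam : ℝ) = L * (s n + 1) := rfl
  set b : ℝ≥0 := lam * (K + 2) * ⟨L, hL0.le⟩ with hb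
  have hbR : (b : ℝ) = L * (s n + 1) * (K + 2) * L := rfl
  have hlam0 : 0 < lam := by
    rw [← NNReal.coe_pos, hlamR]
    positivity
  have hs0 := (s n).coe_nonneg
  have hK0 : (0 : ℝ) ≤ K := K.cast_nonneg
  refine ⟨K, b, lam, ?_, hlam0, ?_, fun C hC => ?_⟩
  · rw [← NNReal.coe_le_coe, hbR, NNReal.coe_one]
    exact one_le_mul_of_one_le_of_one_le (one_le_mul_of_one_le_of_one_le
      (one_le_mul_of_one_le_of_one_le (by linarith) (by linarith)) (by linarith)) (by linarith)
  · rw [← NNReal.coe_le_coe]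
    push_cast
    rw [← Real.log_le_log_iff (by positivity) (by exact_mod_cast hn), Real.log_pow]
    have hbX : (b : ℝ) + 1 ≤ Real.exp (-10) * X ^ 2 := by
      have h4 : (b : ℝ) ≤ η * X ^ 2 := by
        calc (b : ℝ) = L * L * ((s n + 1) * (K + 2)) := by rw [hbR]; ring
          _ ≤ L * L * (η * (X / L) * (X / L)) := by gcongr
          _ = η * X ^ 2 := by field_simp
      have h5 : 1 ≤ η * X ^ 2 := by nlinarith
      have h6 : Real.exp (-10) * X ^ 2 = 2 * (η * X ^ 2) := by rw [hη]; ring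
      linarith
    have hlog : Real.log ((b : ℝ) + 1) ≤ 2 * L - 10 := by
      refine (Real.log_le_log (by positivity) hbX).trans_eq ?_
      rw [Real.log_mul (by positivity) (by positivity), Real.log_exp, Real.log_pow]
      push_cast
      ring
    calc (K : ℝ) * Real.log (b + 1) ≤ K * (2 * L - 10) := by gcongr
      _ ≤ y * (2 * L - 10) := by
          have : 0 ≤ 2 * L - 10 := by linarith
          gcongr
      _ = X - X * (1 / L + 20 / L ^ 2) := by
          rw [hy]
          field_simp
          ring
      _ ≤ X := sub_le_self _ (by positivity)
  · have hC' : ((K : ℝ) + 1) ≤ C * (1 + lam * (K + 2) / b) + s n * (K + 1) / lam := by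
      exact_mod_cast hC
    have h4 : (lam : ℝ) * (K + 2) / b = 1 / L := by
      rw [hbR, hlamR]
      field_simp
    have h5 : (s n : ℝ) * (K + 1) / lam ≤ (K + 1) / L := by
      rw [hlamR, div_le_div_iff₀ (by positivity) hL0]
      nlinarith [mul_nonneg hL0.le (by linarith : (0 : ℝ) ≤ K + 1)]
    rw [h4] at hC'
    have h6 : y * (1 - 1 / L) ≤ C * (1 + 1 / L) := by
      have : 0 ≤ 1 - 1 / L := by
        rw [sub_nonneg, div_le_one hL0]
        linarith
      calc y * (1 - 1 / L) ≤ (K + 1) * (1 - 1 / L) := by gcongr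
        _ = (K + 1) - (K + 1) / L := by ring
        _ ≤ _ := by linarith
    have h7 : X / (2 * L) * (1 + 1 / L) ≤ y * (1 - 1 / L) := by
      have : y * (1 - 1 / L) - X / (2 * L) * (1 + 1 / L) = X / L ^ 3 * (L - 2) := by
        rw [hy]
        field_simp
        ring
      have : 0 ≤ X / L ^ 3 * (L - 2) := mul_nonneg (by positivity) (by linarith)
      linarith
    exact le_of_mul_le_mul_right (h7.trans h6) (by positivity)

/-- Randomized algorithms have competitive ratio at least `ln n / (2 ln ln n)`, for every speed
`s = o(ln n / ln ln n)`. -/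
theorem eventually_le_of_isCompetitive {s : ℕ → ℝ≥0}
    (hs : (fun n => (s n : ℝ)) =o[atTop] fun n : ℕ => Real.log n / Real.log (Real.log n)) :
    ∀ᶠ n : ℕ in atTop, 0 < Real.log n / (2 * Real.log (Real.log n)) ∧
      ∀ p : ℝ≥0, 0 < p → ∀ c : ℝ, c < Real.log n / (2 * Real.log (Real.log n)) →
        ∀ (Ω : Type*) [MeasurableSpace Ω] (μ : Measure Ω) [IsProbabilityMeasure μ]
          (A : RandomizedAlgorithm Ω n (s n * p)), ¬ A.IsCompetitive μ p c := by
  filter_upwards [eventually_le_of_tradeoff hs, tendsto_log_log_natCast.eventually_gt_atTop 0,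
    tendsto_log_natCast.eventually_gt_atTop 0] with n ⟨K, b, lam, hb, hlam, hn, H⟩ hL hX
  refine ⟨by positivity, fun p hp c hc Ω _ μ _ A hA => ?_⟩
  have := H _ (hA.le_add hp hb hlam hn)
  rw [Real.coe_toNNReal', le_max_iff] at this
  rcases this with h | h
  · linarith
  · have : 0 < Real.log n / (2 * Real.log (Real.log n)) := by positivity
    linarith

/-- A deterministic algorithm as a randomized one. -/
noncomputable def NonClairvoyantAlgorithm.toRandomized {n : ℕ} {P : ℝ≥0}
    (A : NonClairvoyantAlgorithm n P) : RandomizedAlgorithm Unit n P :=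
  ⟨fun _ => A, fun _ => measurable_const⟩

lemma NonClairvoyantAlgorithm.IsCompetitive.toRandomized {n : ℕ} {P p : ℝ≥0} {c : ℝ}
    {A : NonClairvoyantAlgorithm n P} (hA : A.IsCompetitive p c) :
    A.toRandomized.IsCompetitive (Measure.dirac ()) p c := fun J => by
  simpa [NonClairvoyantAlgorithm.toRandomized] using hA J

end Scheduling

theorem mainTheorem2 :
    -- Equi is a well-defined non-clairvoyant algorithm ...
    (∀ (n : ℕ) (p : ℝ≥0), 0 < p →
      ∃! A : Scheduling.NonClairvoyantAlgorithm n p, A.IsEqui) ∧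
    -- ... and it is `(1 + o(1)) ln n / ln ln n`-competitive.
    (∃ ε : ℕ → ℝ, Tendsto ε atTop (𝓝 0) ∧
      ∀ n : ℕ, 3 ≤ n → ∀ p : ℝ≥0, 0 < p →
        ∀ A : Scheduling.NonClairvoyantAlgorithm n p, A.IsEqui →
          A.IsCompetitive p ((1 + ε n) * (Real.log n / Real.log (Real.log n)))) ∧
    -- Lower bounds, for every speed `s = o(ln n / ln ln n)`:
    (∀ s : ℕ → ℝ≥0,
      ((fun n => (s n : ℝ)) =o[atTop] fun n : ℕ => Real.log n / Real.log (Real.log n)) →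
      ∃ N : ℕ, ∀ n : ℕ, N ≤ n → ∀ p : ℝ≥0, 0 < p →
        -- deterministic algorithms
        (∀ c : ℝ, c < Real.log n / (2 * Real.log (Real.log n)) →
          ∀ A : Scheduling.NonClairvoyantAlgorithm n (s n * p), ¬ A.IsCompetitive p c) ∧
        -- randomized algorithms
        (∀ c : ℝ, c < Real.log n / (4 * Real.log (Real.log n)) →
          ∀ (Ω : Type*) [MeasurableSpace Ω] (μ : Measure Ω) [IsProbabilityMeasure μ]
            (A : Scheduling.RandomizedAlgorithm Ω n (s n * p)), ¬ A.IsCompetitive μ p c)) := by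
  refine ⟨fun n p _ => Scheduling.existsUnique_isEqui n p,
    Scheduling.exists_isCompetitive_isEqui, fun s hs => ?_⟩
  -- Two copies are needed because the universe of `Ω` is fixed in each: one is used for `Unit`, the
  -- other for arbitrary seeds.
  obtain ⟨N, hN⟩ := eventually_atTop.1 ((Scheduling.eventually_le_of_isCompetitive hs).and
    (Scheduling.eventually_le_of_isCompetitive hs))
  refine ⟨N, fun n hn p hp => ⟨fun c hc A hA => ?_, fun c hc => ?_⟩⟩
  · exact (hN n hn).1.2 p hp c hc Unit (Measure.dirac ()) A.toRandomized hA.toRandomized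
  -- Randomized algorithms obey the bound with 2 in place of 4, which is stronger because the
  -- quotient is positive.
  · refine (hN n hn).2.2 p hp c (hc.trans_le ?_)
    have h := (hN n hn).2.1
    have h2 : Real.log n / (4 * Real.log (Real.log n))
        = Real.log n / (2 * Real.log (Real.log n)) / 2 := by ring
    rw [h2]
    linarith
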